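/- Let $k$ be an algebraically closed field of characteristic $0$, and fix primitive $n$-th roots of unity $\zeta_n\in k$ ($n\ge 1$) with $\zeta_{mn}^m=\zeta_n$ for all $m,n\ge 1$. Algebras are $k$-algebras, not necessarily associative or unital. An algebra $\mathcal A$ is central-simple if $\mathcal A\mathcal A\neq 0$, its only two-sided ideals are $0$ and $\mathcal A$, and the only $k$-linear endomorphisms of $\mathcal A$ that commute with all left and right multiplications are the scalars. For an $n$-tuple $\sigma=(\sigma_1,\dots,\sigma_n)$ of commuting finite order automorphisms of $\mathcal A$ and $m=(m_1,\dots,m_n)\in\mathbb Z_{>0}^n$ with $\sigma_i^{m_i}=\mathrm{id}$ for all $i$, the multiloop algebra of nullity $n$ is the $\mathbb Z^n$-graded algebra $$M_m(\mathcal A,\sigma)=\bigoplus_{\lambda=(l_1,\dots,l_n)\in\mathbb Z^n}\{u\in\mathcal A\mid \sigma_i(u)=\zeta_{m_i}^{l_i}u\ (1\le i\le n)\}\otimes t^\lambda\ \subseteq\ \mathcal A\otimes k[t_1^{\pm1},\dots,t_n^{\pm1}].$$ For $P=(p_{ij})\in\mathrm{GL}_n(\mathbb Z)$ let $\sigma^P$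 be the tuple with $j$-th entry $\prod_i\sigma_i^{p_{ij}}$, let $\mathcal A^\sigma$ be the set of common fixed points of the $\sigma_i$, and for an algebra isomorphism $\varphi$ from $\mathcal A$ to an algebra $\mathcal A'$ let $\varphi\sigma\varphi^{-1}=(\varphi\sigma_1\varphi^{-1},\dots,\varphi\sigma_n\varphi^{-1})$. The support of a graded algebra $\mathcal B=\bigoplus_{\lambda\in\Lambda}\mathcal B^\lambda$ is $\{\lambda\mid\mathcal B^\lambda\ne 0\}$. A support-isomorphism from a $\Lambda$-graded algebra $\mathcal B$ to a $\Lambda'$-graded algebra $\mathcal B'$ ($\Lambda,\Lambda'$ abelian groups) is an algebra isomorphism $\psi:\mathcal B\to\mathcal B'$ for which there is a group isomorphism $\psi_{\mathrm{su}}$ from the subgroup of $\Lambda$ generated by the support of $\mathcal B$ onto the subgroup of $\Lambda'$ generated by the support of $\mathcal B'$ with $\psi(\mathcal B^\lambda)=\mathcal B'^{\psi_{\mathrm{su}}(\lambda)}$ for all $\lambda$ in the former; $\mathcal B$ and $\mathcal B'$ are support-isomorphic if such a $\psi$ exists. Proposition. Let $\mathcal A,\mathcal A'$ be central-simple algebras,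 and let $\mathcal B=M_m(\mathcal A,\sigma)$ and $\mathcal B'=M_{m'}(\mathcal A',\sigma')$ be multiloop algebras of the same nullity $n$. Then $\mathcal B$ and $\mathcal B'$ are support-isomorphic if and only if there exist $P\in\mathrm{GL}_n(\mathbb Z)$ and an algebra isomorphism $\varphi:\mathcal A\to\mathcal A'$ such that $$\sigma'=\varphi\sigma^P\varphi^{-1}.\qquad(*)$$ In particular, whether $\mathcal B$ and $\mathcal B'$ are support-isomorphic does not depend on $m$ or $m'$. Moreover, if $P\in\mathrm{GL}_n(\mathbb Z)$ and an algebra isomorphism $\varphi:\mathcal A\to\mathcal A'$ satisfy $(*)$, then there is a support-isomorphism $\psi:\mathcal B\to\mathcal B'$ with $\psi(x\otimes 1)=\varphi(x)\otimes 1$ for all $x\in\mathcal A^\sigma$. -/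

import Mathlib

open scoped TensorProduct

namespace Multiloop

section AlgebraIsomorphisms

/-- An isomorphism of (not necessarily associative or unital) `k`-algebras: a `k`-linear
bijection that respects products. -/
structure AlgIso (k A A' : Type*) [Field k] [NonUnitalNonAssocSemiring A] [Module k A]
    [NonUnitalNonAssocSemiring A'] [Module k A'] extends A ≃ₗ[k] A' where
  map_mul' : ∀ x y : A, toFun (x * y) = toFun x * toFun y

variable {k A A' A'' : Type*} [Field k] [NonUnitalNonAssocSemiring A] [Module k A]
  [NonUnitalNonAssocSemiring A'] [Module k A'] [NonUnitalNonAssocSemiring A''] [Module k A'']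

namespace AlgIso

instance : CoeFun (AlgIso k A A') (fun _ => A → A') := ⟨fun f => f.toLinearEquiv⟩

theorem map_mul (f : AlgIso k A A') (x y : A) : f (x * y) = f x * f y := f.map_mul' x y

@[ext]
theorem ext {f g : AlgIso k A A'} (h : ∀ x, f x = g x) : f = g := by
  cases f; cases g; congr 1; exact LinearEquiv.ext h

/-- The identity. -/
def refl : AlgIso k A A where
  toLinearEquiv := LinearEquiv.refl k A
  map_mul' _ _ := rfl

/-- The inverse isomorphism. -/
def symm (f : AlgIso k A A') : AlgIso k A' A where
  toLinearEquiv := f.toLinearEquiv.symm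
  map_mul' x y := by
    apply f.toLinearEquiv.injective
    change f.toLinearEquiv (f.toLinearEquiv.symm (x * y)) =
      f (f.toLinearEquiv.symm x * f.toLinearEquiv.symm y)
    rw [f.map_mul]; simp

/-- `f.trans g` is `g ∘ f`. -/
def trans (f : AlgIso k A A') (g : AlgIso k A' A'') : AlgIso k A A'' where
  toLinearEquiv := f.toLinearEquiv.trans g.toLinearEquiv
  map_mul' x y := by
    change g (f (x * y)) = g (f x) * g (f y)
    rw [f.map_mul, g.map_mul]

end AlgIso

/-- `Aut(A)`, the automorphisms of the algebra `A`. -/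
abbrev Aut (k A : Type*) [Field k] [NonUnitalNonAssocSemiring A] [Module k A] := AlgIso k A A

/-- `Aut(A)` is a group, with `(f * g) x = f (g x)`. -/
instance : Group (Aut k A) where
  mul f g := g.trans f
  one := AlgIso.refl
  inv f := f.symm
  mul_assoc _ _ _ := rfl
  one_mul _ := rfl
  mul_one _ := rfl
  inv_mul_cancel f := AlgIso.ext fun x => f.toLinearEquiv.symm_apply_apply x

/-- For an isomorphism `φ : A → A'` and `f ∈ Aut(A)`, the automorphism `φ f φ⁻¹` of `A'`. -/
def conj (φ : AlgIso k A A') (f : Aut k A) : Aut k A' := (φ.symm.trans f).trans φ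

end AlgebraIsomorphisms

section CentralSimple

variable (k A : Type*) [Field k] [NonUnitalNonAssocRing A] [Module k A]
  [IsScalarTower k A A] [SMulCommClass k A A]

/-- The centroid of `A`: the `k`-linear endomorphisms of `A` that commute with all left and
right multiplications by elements of `A`. -/
def centroid : Subalgebra k (Module.End k A) where
  carrier := {c | ∀ x y : A, c (x * y) = x * c y ∧ c (x * y) = c x * y}
  mul_mem' {c d} hc hd x y := by
    refine ⟨?_, ?_⟩
    · rw [Module.End.mul_apply, (hd x y).1, (hc _ _).1, Module.End.mul_apply]
    · rw [Module.End.mul_apply, (hd x y).2, (hc _ _).2, Module.End.mul_apply]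
  add_mem' {c d} hc hd x y := by
    refine ⟨?_, ?_⟩
    · rw [LinearMap.add_apply, (hc x y).1, (hd x y).1, LinearMap.add_apply, mul_add]
    · rw [LinearMap.add_apply, (hc x y).2, (hd x y).2, LinearMap.add_apply, add_mul]
  algebraMap_mem' r x y := by
    simp [Module.algebraMap_end_apply, mul_smul_comm, smul_mul_assoc]

/-- A subspace `I` is a two-sided ideal of the algebra `A`. -/
def IsIdeal {k A : Type*} [Field k] [NonUnitalNonAssocRing A] [Module k A]
    (I : Submodule k A) : Prop :=
  ∀ a : A, ∀ x ∈ I, a * x ∈ I ∧ x * a ∈ I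

/-- `A` is simple: `A A ≠ 0` and the only ideals are `0` and `A`. -/
def IsSimple : Prop :=
  (∃ x y : A, x * y ≠ 0) ∧ ∀ I : Submodule k A, IsIdeal I → I = ⊥ ∨ I = ⊤

/-- `A` is central-simple: it is simple, and its centroid is `k · id` (the bottom subalgebra
of `End_k(A)`). -/
def IsCentralSimple : Prop := IsSimple k A ∧ centroid k A = ⊥

end CentralSimple

section SupportIsomorphism

variable {k Λ Λ' B B' : Type*} [Field k] [AddCommGroup Λ] [AddCommGroup Λ']
  [NonUnitalNonAssocSemiring B] [Module k B] [NonUnitalNonAssocSemiring B'] [Module k B']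

/-- The support of a grading `𝓑` of `B`, the family of its homogeneous components. -/
def support (𝓑 : Λ → Submodule k B) : Set Λ := {l | 𝓑 l ≠ ⊥}

/-- The subgroup of the grading group generated by the support. -/
def supportSpan (𝓑 : Λ → Submodule k B) : AddSubgroup Λ := AddSubgroup.closure (support 𝓑)

/-- The algebra isomorphism `ψ : B → B'` is a support-isomorphism between the gradings `𝓑` of
`B` and `𝓑'` of `B'`: up to an isomorphism between the subgroups generated by the two
supports it maps homogeneous components onto homogeneous components. -/
def IsSupportIso (𝓑 : Λ → Submodule k B) (𝓑' : Λ' → Submodule k B') (ψ : AlgIso k B B') :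
    Prop :=
  ∃ ψsu : supportSpan 𝓑 ≃+ supportSpan 𝓑', ∀ l : supportSpan 𝓑,
    (𝓑 (l : Λ)).map ψ.toLinearEquiv.toLinearMap = 𝓑' (ψsu l : Λ')

/-- The graded algebras `(B, 𝓑)` and `(B', 𝓑')` are support-isomorphic. -/
def SupportIsomorphic (𝓑 : Λ → Submodule k B) (𝓑' : Λ' → Submodule k B') : Prop :=
  ∃ ψ : AlgIso k B B', IsSupportIso 𝓑 𝓑' ψ

end SupportIsomorphism

/-- A compatible choice of a primitive `n`-th root of unity `ζ n` for each `n > 0`, with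
`ζ (m n) ^ m = ζ n`. -/
structure CompatibleRoots (k : Type*) [Field k] where
  ζ : ℕ+ → k
  primitive : ∀ n : ℕ+, IsPrimitiveRoot (ζ n) n
  compat : ∀ m n : ℕ+, ζ (m * n) ^ (m : ℕ) = ζ n

theorem CompatibleRoots.ne_zero {k : Type*} [Field k] (Z : CompatibleRoots k) (n : ℕ+) :
    Z.ζ n ≠ 0 :=
  (Z.primitive n).ne_zero n.ne_zero

section MultiloopAlgebra

variable {k A A' : Type*} [Field k] [NonUnitalNonAssocRing A] [Module k A]
  [NonUnitalNonAssocRing A'] [Module k A'] {n : ℕ}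

/-- `σ` is an `n`-tuple of commuting automorphisms of finite order. -/
def IsCFO (σ : Fin n → Aut k A) : Prop :=
  (∀ i j, σ i * σ j = σ j * σ i) ∧ ∀ i, IsOfFinOrder (σ i)

/-- `σ^P`, the tuple with `j`-th entry `σ₁^{p₁ⱼ} ⋯ σₙ^{pₙⱼ}`. -/
def tuplePow (σ : Fin n → Aut k A) (P : Matrix.GeneralLinearGroup (Fin n) ℤ) :
    Fin n → Aut k A :=
  fun j => (List.ofFn fun i => σ i ^ (P.val i j)).prod

/-- `A^σ`, the common fixed points of the `σᵢ`. -/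
def fixedPoints (σ : Fin n → Aut k A) : Submodule k A where
  carrier := {u | ∀ i, σ i u = u}
  add_mem' hu hv i := by rw [map_add, hu i, hv i]
  zero_mem' i := map_zero _
  smul_mem' c u hu i := by rw [map_smul, hu i]

/-- The subspace of all `u` with `σᵢ(u) = ζ_{mᵢ}^{lᵢ} u` for all `i`. -/
def eigenspace (Z : CompatibleRoots k) (σ : Fin n → Aut k A) (m : Fin n → ℕ+)
    (l : Fin n → ℤ) : Submodule k A where
  carrier := {u | ∀ i, σ i u = (Z.ζ (m i) ^ l i) • u}
  add_mem' hu hv i := by rw [map_add, hu i, hv i, smul_add]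
  zero_mem' i := by rw [map_zero, smul_zero]
  smul_mem' c u hu i := by rw [map_smul, hu i, smul_comm]

/-- The algebra `k[t₁^{±1}, …, tₙ^{±1}]` of Laurent polynomials, as the group algebra of `ℤⁿ`. -/
abbrev Laurent (k : Type*) [Field k] (n : ℕ) := AddMonoidAlgebra k (Fin n → ℤ)

/-- The monomial `t^l = t₁^{l₁} ⋯ tₙ^{lₙ}`. -/
noncomputable def monomial (k : Type*) [Field k] {n : ℕ} (l : Fin n → ℤ) : Laurent k n :=
  AddMonoidAlgebra.single l 1

/-- The subspace `A^{l̄} ⊗ t^l` of `A ⊗ k[t₁^{±1}, …, tₙ^{±1}]`. -/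
noncomputable def component (Z : CompatibleRoots k) (σ : Fin n → Aut k A) (m : Fin n → ℕ+)
    (l : Fin n → ℤ) : Submodule k (A ⊗[k] Laurent k n) :=
  (eigenspace Z σ m l).map ((TensorProduct.mk k A (Laurent k n)).flip (monomial k l))

variable [IsScalarTower k A A] [SMulCommClass k A A]
  [IsScalarTower k A' A'] [SMulCommClass k A' A']

theorem component_mul (Z : CompatibleRoots k) (σ : Fin n → Aut k A) (m : Fin n → ℕ+)
    {l l' : Fin n → ℤ} {x y : A ⊗[k] Laurent k n}
    (hx : x ∈ component Z σ m l) (hy : y ∈ component Z σ m l') :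
    x * y ∈ component Z σ m (l + l') := by
  obtain ⟨u, hu, rfl⟩ := hx
  obtain ⟨v, hv, rfl⟩ := hy
  refine ⟨u * v, fun i => ?_, ?_⟩
  · rw [AlgIso.map_mul, hu i, hv i, smul_mul_smul_comm, Pi.add_apply,
      zpow_add₀ (Z.ne_zero _)]
  · simp [monomial, AddMonoidAlgebra.single_mul_single]

/-- The multiloop algebra `M_m(A, σ) = ⨁_{l ∈ ℤⁿ} A^{l̄} ⊗ t^l`, a subalgebra of
`A ⊗ k[t₁^{±1}, …, tₙ^{±1}]`. -/
noncomputable def multiloop (Z : CompatibleRoots k) (σ : Fin n → Aut k A) (m : Fin n → ℕ+) :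
    NonUnitalSubalgebra k (A ⊗[k] Laurent k n) :=
  { (⨆ l, component Z σ m l : Submodule k (A ⊗[k] Laurent k n)) with
    mul_mem' := by
      intro x y hx hy
      change x ∈ ⨆ l, component Z σ m l at hx
      change y ∈ ⨆ l, component Z σ m l at hy
      change x * y ∈ ⨆ l, component Z σ m l
      induction hx using Submodule.iSup_induction' with
      | mem l x hx =>
        induction hy using Submodule.iSup_induction' with
        | mem l' y hy => exact Submodule.mem_iSup_of_mem _ (component_mul Z σ m hx hy)
        | zero => rw [mul_zero]; exact Submodule.zero_mem _
        | add y y' _ _ h h' => rw [mul_add]; exact Submodule.add_mem _ h h'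
      | zero => rw [zero_mul]; exact Submodule.zero_mem _
      | add x x' _ _ h h' => rw [add_mul]; exact Submodule.add_mem _ h h' }

/-- The `ℤⁿ`-grading of `M_m(A, σ)`, whose component of degree `l` is `A^{l̄} ⊗ t^l`. -/
noncomputable def grading (Z : CompatibleRoots k) (σ : Fin n → Aut k A) (m : Fin n → ℕ+)
    (l : Fin n → ℤ) : Submodule k (multiloop Z σ m) where
  carrier := {b | (b : A ⊗[k] Laurent k n) ∈ component Z σ m l}
  add_mem' := (component Z σ m l).add_mem
  zero_mem' := (component Z σ m l).zero_mem
  smul_mem' c _ := (component Z σ m l).smul_mem c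

/-- `M_m(A, σ)` and `M_{m'}(A', σ')` are support-isomorphic as `ℤⁿ`-graded algebras. -/
def MultiloopSupportIsomorphic (Z : CompatibleRoots k) (σ : Fin n → Aut k A) (m : Fin n → ℕ+)
    (σ' : Fin n → Aut k A') (m' : Fin n → ℕ+) : Prop :=
  SupportIsomorphic (grading Z σ m) (grading Z σ' m')

theorem tmul_one_mem (Z : CompatibleRoots k) (σ : Fin n → Aut k A) (m : Fin n → ℕ+)
    {x : A} (hx : x ∈ fixedPoints σ) : x ⊗ₜ[k] (1 : Laurent k n) ∈ multiloop Z σ m := by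
  refine Submodule.mem_iSup_of_mem (p := component Z σ m) 0 ⟨x, fun i => ?_, rfl⟩
  rw [hx i, Pi.zero_apply, zpow_zero, one_smul]

/-- The element `x ⊗ 1` of `M_m(A, σ)`, for `x` in `A^σ`. -/
noncomputable def tmulOne (Z : CompatibleRoots k) (σ : Fin n → Aut k A) (m : Fin n → ℕ+)
    (x : fixedPoints σ) : multiloop Z σ m :=
  ⟨(x : A) ⊗ₜ[k] (1 : Laurent k n), tmul_one_mem Z σ m x.2⟩

end MultiloopAlgebra

end Multiloop

namespace Multiloop

/-! ### Pointwise rules for isomorphisms and automorphisms. -/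

namespace AlgIso

variable {k A A' : Type*} [Field k] [NonUnitalNonAssocSemiring A] [Module k A]
  [NonUnitalNonAssocSemiring A'] [Module k A']

/-! Index the simultaneous eigenspaces by `q = l / m` in `ℚⁿ`, using the character `l / m ↦ ζ_m ^ l`
of `ℚ`. In this indexing `m` disappears, and passing from `σ` to `σ^P` becomes the substitution `q ↦
q P`.

If `σ' = φ σ^P φ⁻¹`, both multiloop algebras embed in `A' ⊗ k[ℚⁿ]`, by `u ⊗ t^l ↦ φ(u) ⊗ t^{(l/m)P}`
and `v ⊗ t^l ↦ v ⊗ t^{l/m'}`. Both images are the sum of all `A'^q ⊗ t^q`, so the algebras are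
isomorphic, compatibly with the gradings (`exists_isSupportIso`).

Conversely, compose a support-isomorphism with evaluation at `t = 1` to get a surjective
homomorphism `f` onto `A'`. For `g` in the lattice `Γ = m₁ℤ × ⋯ × mₙℤ`, multiplication by `t^g` is
centroidal, so centrality of `A'` makes `f` absorb it as a nonzero scalar
(`IsSpecialization.exists_scalar`). This has two consequences. The scalars are values of a character
which, `k` being algebraically closed, extends from `Γ` to `ℤⁿ` as `l ↦ b^l`; then `u ↦ b^{-l} f(u ⊗
t^l)` on each `A^l` is a well-defined isomorphism `φ` (`IsSpecialization.exists_algIso`). Also, the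
isomorphism of support groups matches `Γ` with its counterpart `Γ'` (`map_periodLattice`); in
rational coordinates both are `ℤⁿ`, which yields `P` (`exists_generalLinear`). Comparing eigenvalues
gives the conjugacy (`IsSupportIso.exists_conj`). -/

@[simp] theorem symm_apply_self (f : AlgIso k A A') (x : A) : f.symm (f x) = x :=
  f.toLinearEquiv.symm_apply_apply x

@[simp] theorem self_apply_symm (f : AlgIso k A A') (x : A') : f (f.symm x) = x :=
  f.toLinearEquiv.apply_symm_apply x

theorem conj_apply (φ : AlgIso k A A') (f : Aut k A) (x : A') :
    conj φ f x = φ (f (φ.symm x)) := rfl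

theorem aut_mul_apply (f g : Aut k A) (x : A) : (f * g) x = f (g x) := rfl

theorem aut_one_apply (x : A) : (1 : Aut k A) x = x := rfl

/-- The action of automorphisms by linear endomorphisms. -/
def autToEnd : Aut k A →* Module.End k A where
  toFun f := f.toLinearEquiv.toLinearMap
  map_one' := rfl
  map_mul' _ _ := rfl

/-- A bijective multiplicative linear map as an isomorphism of algebras. -/
noncomputable def ofBijective (f : A →ₗ[k] A') (hf : Function.Bijective f)
    (hmul : ∀ x y, f (x * y) = f x * f y) : AlgIso k A A' where
  toLinearEquiv := LinearEquiv.ofBijective f hf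
  map_mul' := hmul

end AlgIso

/-! ### The character of `ℚ` defined by the roots of unity. -/

section RootsOfUnity

variable {k : Type*} [Field k]

/-- By compatibility both sides are powers of `ζ_{m m'}`, and clearing denominators equates the
exponents. -/
theorem CompatibleRoots.zpow_eq_zpow (Z : CompatibleRoots k) {m m' : ℕ+} {l l' : ℤ}
    (h : (l : ℚ) / m = l' / m') : Z.ζ m ^ l = Z.ζ m' ^ l' := by
  have hm : (m : ℚ) ≠ 0 := by exact_mod_cast m.ne_zero
  have hm' : (m' : ℚ) ≠ 0 := by exact_mod_cast m'.ne_zero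
  rw [div_eq_div_iff hm hm'] at h
  have h' : ((m' : ℕ) : ℤ) * l = ((m : ℕ) : ℤ) * l' := by
    have : ((m' : ℕ) : ℚ) * l = ((m : ℕ) : ℚ) * l' := by linarith
    exact_mod_cast this
  rw [← Z.compat m' m, ← Z.compat m m', mul_comm m' m, ← zpow_natCast, ← zpow_natCast,
    ← zpow_mul, ← zpow_mul, h']

/-- The character `l / m ↦ ζ_m ^ l` of `ℚ`. -/
noncomputable def CompatibleRoots.char (Z : CompatibleRoots k) : AddChar ℚ k where
  toFun q := Z.ζ ⟨q.den, q.den_pos⟩ ^ q.num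
  map_zero_eq_one' := by simp
  map_add_eq_mul' p q := by
    set d : ℕ+ := ⟨p.den, p.den_pos⟩
    set d' : ℕ+ := ⟨q.den, q.den_pos⟩
    have hd : (d : ℚ) ≠ 0 := by exact_mod_cast d.ne_zero
    have hd' : (d' : ℚ) ≠ 0 := by exact_mod_cast d'.ne_zero
    have hp : p = p.num / (d : ℚ) := (Rat.num_div_den p).symm
    have hq : q = q.num / (d' : ℚ) := (Rat.num_div_den q).symm
    have e1 : Z.ζ d ^ p.num = Z.ζ (d * d') ^ (p.num * (d' : ℤ)) := by
      apply Z.zpow_eq_zpow; push_cast; field_simp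
    have e2 : Z.ζ d' ^ q.num = Z.ζ (d * d') ^ (q.num * (d : ℤ)) := by
      apply Z.zpow_eq_zpow; push_cast; field_simp
    rw [e1, e2, ← zpow_add₀ (Z.ne_zero _)]
    apply Z.zpow_eq_zpow
    have := Rat.num_div_den (p + q)
    rw [PNat.mk_coe, this]
    conv_lhs => rw [hp, hq]
    push_cast; field_simp

theorem CompatibleRoots.char_div (Z : CompatibleRoots k) (m : ℕ+) (l : ℤ) :
    Z.char ((l : ℚ) / m) = Z.ζ m ^ l := by
  apply Z.zpow_eq_zpow
  exact Rat.num_div_den _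

theorem CompatibleRoots.char_ne_zero (Z : CompatibleRoots k) (q : ℚ) : Z.char q ≠ 0 :=
  zpow_ne_zero _ (Z.ne_zero _)

theorem CompatibleRoots.char_eq_one (Z : CompatibleRoots k) {q : ℚ} (h : Z.char q = 1) :
    ∃ l : ℤ, q = l := by
  have := (Z.primitive ⟨q.den, q.den_pos⟩).zpow_eq_one_iff_dvd q.num |>.1 h
  obtain ⟨c, hc⟩ := this
  refine ⟨c, ?_⟩
  have h0 : (q.den : ℚ) ≠ 0 := by exact_mod_cast q.den_nz
  have hq := Rat.num_div_den q
  rw [hc] at hq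
  rw [← hq]; push_cast; simp

end RootsOfUnity

/-! ### The action of `GLₙ(ℤ)` on commuting tuples. -/

section TuplePow

variable {k A A' : Type*} [Field k] [NonUnitalNonAssocRing A] [Module k A]
  [NonUnitalNonAssocRing A'] [Module k A'] {n : ℕ}

-- The ambient group need not be commutative. Lifting the tuple to the commutative subgroup that it
-- generates makes `Finset` products available.
open scoped IsMulCommutative in
theorem exists_commGroup_hom.{u} {G : Type u} [Group G] (s : Fin n → G)
    (hs : ∀ i j, s i * s j = s j * s i) :
    ∃ (H : Type u) (_ : CommGroup H) (f : H →* G) (h : Fin n → H), ∀ i, s i = f (h i) := by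
  have hc : ∀ x ∈ Set.range s, ∀ y ∈ Set.range s, x * y = y * x := by
    rintro _ ⟨i, rfl⟩ _ ⟨j, rfl⟩; exact hs i j
  have := Subgroup.isMulCommutative_closure hc
  exact ⟨Subgroup.closure (Set.range s), inferInstance,
    (Subgroup.closure (Set.range s)).subtype,
    fun i => ⟨s i, Subgroup.subset_closure ⟨i, rfl⟩⟩, fun i => rfl⟩

theorem tuplePow_hom {H : Type*} [CommGroup H] (f : H →* Aut k A) (h : Fin n → H)
    (P : Matrix.GeneralLinearGroup (Fin n) ℤ) (j : Fin n) :
    tuplePow (fun i => f (h i)) P j = f (∏ i, h i ^ P.val i j) := by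
  rw [tuplePow, ← List.prod_ofFn, map_list_prod, List.map_ofFn]
  simp [Function.comp_def]

theorem tuplePow_mul {σ : Fin n → Aut k A} (hσ : ∀ i j, σ i * σ j = σ j * σ i)
    (P Q : Matrix.GeneralLinearGroup (Fin n) ℤ) :
    tuplePow (tuplePow σ P) Q = tuplePow σ (P * Q) := by
  obtain ⟨H, _, f, h, hf⟩ := exists_commGroup_hom σ hσ
  obtain rfl : σ = fun i => f (h i) := funext hf
  have e := funext (tuplePow_hom f h P)
  funext l
  rw [e, tuplePow_hom f, tuplePow_hom f]
  congr 1
  simp only [Units.val_mul, Matrix.mul_apply, ← Finset.prod_zpow, ← zpow_mul]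
  rw [Finset.prod_comm]
  refine Finset.prod_congr rfl fun i _ => ?_
  induction (Finset.univ : Finset (Fin n)) using Finset.induction_on with
  | empty => simp
  | insert a s ha ih => rw [Finset.prod_insert ha, Finset.sum_insert ha, zpow_add, ih]

theorem tuplePow_one (σ : Fin n → Aut k A) (hσ : ∀ i j, σ i * σ j = σ j * σ i) :
    tuplePow σ 1 = σ := by
  obtain ⟨H, _, f, h, hf⟩ := exists_commGroup_hom σ hσ
  obtain rfl : σ = fun i => f (h i) := funext hf
  funext l
  rw [tuplePow_hom f]
  congr 1
  rw [Finset.prod_eq_single l] <;> simp +contextual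

end TuplePow

/-! ### Simultaneous eigenspaces indexed by `ℚⁿ`. -/

section RatEigenspace

variable {k A A' : Type*} [Field k] [NonUnitalNonAssocRing A] [Module k A]
  [NonUnitalNonAssocRing A'] [Module k A'] {n : ℕ}

/-- The eigenspaces of a tuple indexed by `ℚⁿ`: all `u` with `σᵢ(u) = ζ(qᵢ) u`, where
`ζ(l / m) = ζ_m ^ l`. -/
def ratEigenspace (Z : CompatibleRoots k) (σ : Fin n → Aut k A) (q : Fin n → ℚ) :
    Submodule k A where
  carrier := {u | ∀ i, σ i u = Z.char (q i) • u}
  add_mem' hu hv i := by rw [map_add, hu i, hv i, smul_add]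
  zero_mem' i := by rw [map_zero, smul_zero]
  smul_mem' c u hu i := by rw [map_smul, hu i, smul_comm]

theorem mem_ratEigenspace {Z : CompatibleRoots k} {σ : Fin n → Aut k A} {q : Fin n → ℚ} {u : A} :
    u ∈ ratEigenspace Z σ q ↔ ∀ i, σ i u = Z.char (q i) • u := Iff.rfl

theorem mem_eigenspace {Z : CompatibleRoots k} {σ : Fin n → Aut k A} {m : Fin n → ℕ+}
    {l : Fin n → ℤ} {u : A} :
    u ∈ eigenspace Z σ m l ↔ ∀ i, σ i u = (Z.ζ (m i) ^ l i) • u := Iff.rfl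

/-- The embedding `l ↦ (lᵢ / mᵢ)ᵢ` of `ℤⁿ` into `ℚⁿ`. -/
def ratIndex (m : Fin n → ℕ+) : (Fin n → ℤ) →+ (Fin n → ℚ) where
  toFun l i := (l i : ℚ) / m i
  map_zero' := by ext; simp
  map_add' l l' := by ext; simp [add_div]

theorem ratIndex_apply (m : Fin n → ℕ+) (l : Fin n → ℤ) (i : Fin n) :
    ratIndex m l i = (l i : ℚ) / m i := rfl

theorem ratIndex_injective (m : Fin n → ℕ+) : Function.Injective (ratIndex m) := by
  intro l l' h
  ext i
  have := congrFun h i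
  have hm : ((m i : ℕ) : ℚ) ≠ 0 := by exact_mod_cast (m i).ne_zero
  simpa [ratIndex_apply, div_left_inj' hm] using this

theorem eigenspace_eq_ratEigenspace (Z : CompatibleRoots k) (σ : Fin n → Aut k A)
    (m : Fin n → ℕ+) (l : Fin n → ℤ) :
    eigenspace Z σ m l = ratEigenspace Z σ (ratIndex m l) := by
  ext u
  simp only [mem_eigenspace, mem_ratEigenspace, ratIndex_apply, Z.char_div]

theorem pow_apply_of_eq_smul {τ : Aut k A} {c : k} {u : A} (h : τ u = c • u) (N : ℕ) :
    (τ ^ N) u = c ^ N • u := by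
  induction N with
  | zero => simp [AlgIso.aut_one_apply]
  | succ N ih => rw [pow_succ, AlgIso.aut_mul_apply, h, map_smul, ih, smul_smul, pow_succ']

theorem zpow_apply_of_eq_smul {τ : Aut k A} {c : k} (hc : c ≠ 0) {u : A} (h : τ u = c • u)
    (N : ℤ) : (τ ^ N) u = c ^ N • u := by
  cases N with
  | ofNat N => simpa using pow_apply_of_eq_smul h N
  | negSucc N =>
    have h' := pow_apply_of_eq_smul h (N + 1)
    rw [zpow_negSucc, zpow_negSucc]
    apply (τ ^ (N + 1)).toLinearEquiv.injective
    rw [map_smul, h', smul_smul, inv_mul_cancel₀ (pow_ne_zero _ hc), one_smul,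
      ← AlgIso.aut_mul_apply, mul_inv_cancel, AlgIso.aut_one_apply]

/-- On a nonzero eigenvector `σᵢ^{mᵢ} = 1` forces the character to be trivial at `mᵢ qᵢ`, and its
kernel is `ℤ`. -/
theorem ratEigenspace_eq_bot (Z : CompatibleRoots k) {σ : Fin n → Aut k A} {m : Fin n → ℕ+}
    (hm : ∀ i, σ i ^ (m i : ℕ) = 1) {q : Fin n → ℚ} (hq : q ∉ Set.range (ratIndex m)) :
    ratEigenspace Z σ q = ⊥ := by
  rw [Submodule.eq_bot_iff]
  intro u hu
  by_contra hu0
  refine hq ?_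
  have key : ∀ i, ∃ l : ℤ, (m i : ℚ) * q i = l := fun i => by
    apply Z.char_eq_one
    have h := pow_apply_of_eq_smul (hu i) (m i)
    rw [hm i, AlgIso.aut_one_apply, ← AddChar.map_nsmul_eq_pow] at h
    have h' : (1 - Z.char ((m i : ℕ) • q i)) • u = 0 := by rw [sub_smul, ← h, one_smul, sub_self]
    rcases smul_eq_zero.1 h' with h' | h'
    · rw [← nsmul_eq_mul]; exact (sub_eq_zero.1 h').symm
    · exact absurd h' hu0
  choose l hl using key
  refine ⟨l, ?_⟩
  ext i
  have hm : ((m i : ℕ) : ℚ) ≠ 0 := by exact_mod_cast (m i).ne_zero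
  rw [ratIndex_apply, ← hl i]; field_simp

/-- The automorphism `q ↦ q P` of `ℚⁿ`. -/
def ratVecMul (P : Matrix.GeneralLinearGroup (Fin n) ℤ) : (Fin n → ℚ) →+ (Fin n → ℚ) where
  toFun q := Matrix.vecMul q (P.val.map (Int.castRingHom ℚ))
  map_zero' := Matrix.zero_vecMul _
  map_add' := Matrix.add_vecMul _

theorem ratVecMul_apply (P : Matrix.GeneralLinearGroup (Fin n) ℤ) (q : Fin n → ℚ) (j : Fin n) :
    ratVecMul P q j = ∑ i, q i * P.val i j := by
  simp [ratVecMul, Matrix.vecMul, dotProduct]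

theorem ratVecMul_mul (P Q : Matrix.GeneralLinearGroup (Fin n) ℤ) (q : Fin n → ℚ) :
    ratVecMul Q (ratVecMul P q) = ratVecMul (P * Q) q := by
  change Matrix.vecMul (Matrix.vecMul q (P.val.map (Int.castRingHom ℚ)))
    (Q.val.map (Int.castRingHom ℚ)) = Matrix.vecMul q ((P * Q).val.map (Int.castRingHom ℚ))
  rw [Matrix.vecMul_vecMul, Units.val_mul, Matrix.map_mul]

theorem ratVecMul_one (q : Fin n → ℚ) : ratVecMul 1 q = q := by
  simp [ratVecMul, Matrix.map_one]

theorem ratVecMul_inv (P : Matrix.GeneralLinearGroup (Fin n) ℤ) (q : Fin n → ℚ) :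
    ratVecMul P⁻¹ (ratVecMul P q) = q := by
  rw [ratVecMul_mul, mul_inv_cancel, ratVecMul_one]

theorem ratVecMul_inv' (P : Matrix.GeneralLinearGroup (Fin n) ℤ) (q : Fin n → ℚ) :
    ratVecMul P (ratVecMul P⁻¹ q) = q := by
  rw [ratVecMul_mul, inv_mul_cancel, ratVecMul_one]

theorem ratEigenspace_le_tuplePow (Z : CompatibleRoots k) (σ : Fin n → Aut k A)
    (P : Matrix.GeneralLinearGroup (Fin n) ℤ) (q : Fin n → ℚ) :
    ratEigenspace Z σ q ≤ ratEigenspace Z (tuplePow σ P) (ratVecMul P q) := by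
  intro u hu j
  have key : ∀ L : List (Fin n), (L.map fun i => σ i ^ (P.val i j)).prod u =
      Z.char ((L.map fun i => q i * P.val i j).sum) • u := by
    intro L
    induction L with
    | nil => simp [AlgIso.aut_one_apply]
    | cons i L ih =>
      rw [List.map_cons, List.prod_cons, AlgIso.aut_mul_apply, ih, map_smul, List.map_cons,
        List.sum_cons, AddChar.map_add_eq_mul,
        zpow_apply_of_eq_smul (Z.char_ne_zero _) (hu i), smul_smul, mul_comm,
        ← AddChar.map_zsmul_eq_zpow, zsmul_eq_mul, mul_comm (q i)]
  have := key (List.finRange n)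
  rw [← List.ofFn_eq_map, ← List.ofFn_eq_map, List.sum_ofFn] at this
  rw [ratVecMul_apply]
  exact this

/-- The reverse inclusion is the known one applied to `σ^P` and `P⁻¹`; commutativity enters through
`(σ^P)^{P⁻¹} = σ`. -/
theorem ratEigenspace_tuplePow (Z : CompatibleRoots k) {σ : Fin n → Aut k A}
    (hσ : ∀ i j, σ i * σ j = σ j * σ i)
    (P : Matrix.GeneralLinearGroup (Fin n) ℤ) (q : Fin n → ℚ) :
    ratEigenspace Z (tuplePow σ P) (ratVecMul P q) = ratEigenspace Z σ q := by
  refine le_antisymm ?_ (ratEigenspace_le_tuplePow Z σ P q)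
  have := ratEigenspace_le_tuplePow Z (tuplePow σ P) P⁻¹ (ratVecMul P q)
  rwa [tuplePow_mul hσ, mul_inv_cancel, tuplePow_one σ hσ, ratVecMul_inv] at this

theorem map_ratEigenspace_conj (Z : CompatibleRoots k) (φ : AlgIso k A A') (σ : Fin n → Aut k A)
    (q : Fin n → ℚ) : (ratEigenspace Z σ q).map φ.toLinearEquiv.toLinearMap =
      ratEigenspace Z (fun i => conj φ (σ i)) q := by
  ext v
  constructor
  · rintro ⟨u, hu, rfl⟩ i
    change φ (σ i (φ.symm (φ u))) = _ • φ u
    rw [AlgIso.symm_apply_self, hu i, map_smul]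
  · intro hv
    refine ⟨φ.symm v, fun i => ?_, φ.self_apply_symm v⟩
    have := hv i
    rw [AlgIso.conj_apply] at this
    apply φ.toLinearEquiv.injective
    rw [this, map_smul, AlgIso.self_apply_symm]

end RatEigenspace

theorem map_eq_bot_iff_of_injective {k M N : Type*} [Field k] [AddCommGroup M] [Module k M]
    [AddCommGroup N] [Module k N] {f : M →ₗ[k] N} (hf : Function.Injective f)
    {S : Submodule k M} : S.map f = ⊥ ↔ S = ⊥ :=
  (Submodule.map_injective_of_injective hf).eq_iff' (Submodule.map_bot f)

/-! ### Comparison with the group algebra of `ℚⁿ`. -/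

section RatGradedMap

variable {k A A' : Type*} [Field k] [NonUnitalNonAssocRing A] [Module k A]
  [NonUnitalNonAssocRing A'] [Module k A'] {n : ℕ}

/-- The subspace `A^q ⊗ t^q` of `A ⊗ k[ℚⁿ]`. -/
noncomputable def ratComponent (Z : CompatibleRoots k) (σ : Fin n → Aut k A) (q : Fin n → ℚ) :
    Submodule k (A ⊗[k] AddMonoidAlgebra k (Fin n → ℚ)) :=
  (ratEigenspace Z σ q).map ((TensorProduct.mk k A _).flip (AddMonoidAlgebra.single q 1))

/-- The linear map `A ⊗ k[ℤⁿ] → A' ⊗ k[ℚⁿ]` sending `u ⊗ t^l` to `φ(u) ⊗ t^{h(l)}`. -/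
noncomputable def ratGradedMap (φ : AlgIso k A A') (h : (Fin n → ℤ) →+ (Fin n → ℚ)) :
    A ⊗[k] Laurent k n →ₗ[k] A' ⊗[k] AddMonoidAlgebra k (Fin n → ℚ) :=
  TensorProduct.map φ.toLinearEquiv.toLinearMap
    (AddMonoidAlgebra.mapDomainAlgHom k k h).toLinearMap

theorem ratGradedMap_tmul (φ : AlgIso k A A') (h : (Fin n → ℤ) →+ (Fin n → ℚ)) (u : A)
    (l : Fin n → ℤ) : ratGradedMap φ h (u ⊗ₜ monomial k l) =
      φ u ⊗ₜ AddMonoidAlgebra.single (h l) 1 := by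
  simp [ratGradedMap, monomial]

theorem ratGradedMap_injective (φ : AlgIso k A A') {h : (Fin n → ℤ) →+ (Fin n → ℚ)}
    (hh : Function.Injective h) : Function.Injective (ratGradedMap φ h) :=
  TensorProduct.map_injective_of_flat_flat _ _ φ.toLinearEquiv.injective
    (AddMonoidAlgebra.mapDomain_injective hh)

theorem tmul_monomial_eq_zero {u : A} {l : Fin n → ℤ} :
    u ⊗ₜ[k] monomial k l = 0 ↔ u = 0 := by
  refine ⟨fun h => ?_, fun h => by rw [h, TensorProduct.zero_tmul]⟩
  have := congrArg (TensorProduct.rid k A ∘ (LinearMap.lTensor A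
    (AddMonoidAlgebra.lift k k (Fin n → ℤ) 1).toLinearMap)) h
  simpa [monomial] using this

theorem ratGradedMap_map_component {Z : CompatibleRoots k} {σ : Fin n → Aut k A}
    {m : Fin n → ℕ+} {σ' : Fin n → Aut k A'} {φ : AlgIso k A A'}
    {h : (Fin n → ℤ) →+ (Fin n → ℚ)}
    (hE : ∀ l, (eigenspace Z σ m l).map φ.toLinearEquiv.toLinearMap = ratEigenspace Z σ' (h l))
    (l : Fin n → ℤ) :
    (component Z σ m l).map (ratGradedMap φ h) = ratComponent Z σ' (h l) := by
  rw [component, ratComponent, ← hE, ← Submodule.map_comp, ← Submodule.map_comp]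
  congr 1
  ext u
  exact ratGradedMap_tmul φ h u l

/-- The right side involves only `σ'`. Hence any two multiloop algebras satisfying these hypotheses
for the same `σ'` have the same image. -/
theorem iSup_ratGradedMap_component {Z : CompatibleRoots k} {σ : Fin n → Aut k A}
    {m : Fin n → ℕ+} {σ' : Fin n → Aut k A'} {φ : AlgIso k A A'}
    {h : (Fin n → ℤ) →+ (Fin n → ℚ)}
    (hE : ∀ l, (eigenspace Z σ m l).map φ.toLinearEquiv.toLinearMap = ratEigenspace Z σ' (h l))
    (hr : ∀ q ∉ Set.range h, ratEigenspace Z σ' q = ⊥) :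
    (⨆ l, component Z σ m l).map (ratGradedMap φ h) = ⨆ q, ratComponent Z σ' q := by
  rw [Submodule.map_iSup]
  simp only [ratGradedMap_map_component hE]
  refine le_antisymm (iSup_le fun l => le_iSup (ratComponent Z σ') (h l)) (iSup_le fun q => ?_)
  by_cases hq : q ∈ Set.range h
  · obtain ⟨l, rfl⟩ := hq
    exact le_iSup (fun l => ratComponent Z σ' (h l)) l
  · rw [ratComponent, hr q hq, Submodule.map_bot]; exact bot_le

end RatGradedMap

/-! ### From a conjugacy to a support-isomorphism. -/

section Grading

variable {k A A' : Type*} [Field k] [NonUnitalNonAssocRing A] [Module k A]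
  [IsScalarTower k A A] [SMulCommClass k A A] [NonUnitalNonAssocRing A'] [Module k A']
  [IsScalarTower k A' A'] [SMulCommClass k A' A'] {n : ℕ}

theorem ratGradedMap_mul (φ : AlgIso k A A') (h : (Fin n → ℤ) →+ (Fin n → ℚ))
    (x y : A ⊗[k] Laurent k n) :
    ratGradedMap φ h (x * y) = ratGradedMap φ h x * ratGradedMap φ h y := by
  induction x using TensorProduct.induction_on with
  | zero => simp
  | add x x' hx hx' => rw [add_mul, map_add, map_add, add_mul, hx, hx']
  | tmul u a =>
    induction y using TensorProduct.induction_on with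
    | zero => simp
    | add y y' hy hy' => rw [mul_add, map_add, map_add, mul_add, hy, hy']
    | tmul v b => simp [ratGradedMap, AlgIso.map_mul, AddMonoidAlgebra.mapDomain_mul]

theorem multiloop_toSubmodule (Z : CompatibleRoots k) (σ : Fin n → Aut k A) (m : Fin n → ℕ+) :
    (multiloop Z σ m).toSubmodule = ⨆ l, component Z σ m l := rfl

theorem component_le (Z : CompatibleRoots k) (σ : Fin n → Aut k A) (m : Fin n → ℕ+)
    (l : Fin n → ℤ) : component Z σ m l ≤ (multiloop Z σ m).toSubmodule :=
  le_iSup (component Z σ m) l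

theorem grading_map_subtype (Z : CompatibleRoots k) (σ : Fin n → Aut k A) (m : Fin n → ℕ+)
    (l : Fin n → ℤ) :
    (grading Z σ m l).map (multiloop Z σ m).toSubmodule.subtype = component Z σ m l := by
  ext x
  constructor
  · rintro ⟨y, hy, rfl⟩; exact hy
  · intro hx; exact ⟨⟨x, component_le Z σ m l hx⟩, hx, rfl⟩

omit [IsScalarTower k A A] [SMulCommClass k A A] in
theorem component_ne_bot {Z : CompatibleRoots k} {σ : Fin n → Aut k A} {m : Fin n → ℕ+}
    {l : Fin n → ℤ} : component Z σ m l ≠ ⊥ ↔ eigenspace Z σ m l ≠ ⊥ := by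
  rw [not_iff_not, Submodule.eq_bot_iff, Submodule.eq_bot_iff]
  constructor
  · intro h u hu
    exact tmul_monomial_eq_zero.1 (h _ ⟨u, hu, rfl⟩)
  · rintro h _ ⟨u, hu, rfl⟩
    rw [h u hu, map_zero]

theorem mem_support_grading {Z : CompatibleRoots k} {σ : Fin n → Aut k A} {m : Fin n → ℕ+}
    {l : Fin n → ℤ} : l ∈ support (grading Z σ m) ↔ eigenspace Z σ m l ≠ ⊥ := by
  rw [← component_ne_bot, ← grading_map_subtype, ne_eq, map_eq_bot_iff_of_injective (Submodule.subtype_injective _)]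
  exact Iff.rfl

omit [IsScalarTower k A' A'] [SMulCommClass k A' A'] in
/-- The image of the support under a map compatible with eigenspaces. -/
theorem image_support_grading {Z : CompatibleRoots k} {σ : Fin n → Aut k A}
    {m : Fin n → ℕ+} {σ' : Fin n → Aut k A'} {φ : AlgIso k A A'}
    {h : (Fin n → ℤ) →+ (Fin n → ℚ)}
    (hE : ∀ l, (eigenspace Z σ m l).map φ.toLinearEquiv.toLinearMap = ratEigenspace Z σ' (h l))
    (hr : ∀ q ∉ Set.range h, ratEigenspace Z σ' q = ⊥) :
    h '' support (grading Z σ m) = {q | ratEigenspace Z σ' q ≠ ⊥} := by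
  have key : ∀ l, l ∈ support (grading Z σ m) ↔ ratEigenspace Z σ' (h l) ≠ ⊥ := fun l => by
    rw [mem_support_grading, ← hE, ne_eq, ne_eq,
      map_eq_bot_iff_of_injective φ.toLinearEquiv.injective]
  ext q
  constructor
  · rintro ⟨l, hl, rfl⟩; exact (key l).1 hl
  · intro hq
    by_cases hq' : q ∈ Set.range h
    · obtain ⟨l, rfl⟩ := hq'
      exact ⟨l, (key l).2 hq, rfl⟩
    · exact absurd (hr q hq') hq

omit [IsScalarTower k A A] [SMulCommClass k A A] in
theorem AlgIso.map_refl (S : Submodule k A) :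
    S.map (AlgIso.refl : AlgIso k A A).toLinearEquiv.toLinearMap = S := Submodule.map_id S

/-- Two injective multiplicative maps with the same range yield an isomorphism. -/
theorem AlgIso.exists_of_range_eq {B B' C : Type*} [NonUnitalNonAssocSemiring B] [Module k B]
    [NonUnitalNonAssocSemiring B'] [Module k B'] [NonUnitalNonAssocSemiring C] [Module k C]
    {g : B →ₗ[k] C} {g' : B' →ₗ[k] C} (hg : Function.Injective g) (hg' : Function.Injective g')
    (hmul : ∀ x y, g (x * y) = g x * g y) (hmul' : ∀ x y, g' (x * y) = g' x * g' y)
    (hr : LinearMap.range g = LinearMap.range g') :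
    ∃ ψ : AlgIso k B B', ∀ x, g' (ψ x) = g x := by
  let e : B ≃ₗ[k] B' := (LinearEquiv.ofInjective g hg).trans
    ((LinearEquiv.ofEq _ _ hr).trans (LinearEquiv.ofInjective g' hg').symm)
  have he : ∀ x, g' (e x) = g x := fun x =>
    congrArg Subtype.val ((LinearEquiv.ofInjective g' hg').apply_symm_apply
      (LinearEquiv.ofEq _ _ hr (LinearEquiv.ofInjective g hg x)))
  refine ⟨⟨e, fun x y => hg' ?_⟩, he⟩
  change g' (e (x * y)) = g' (e x * e y)
  rw [he, hmul, hmul', he, he]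

theorem exists_addEquiv_of_map_eq {G G' H : Type*} [AddCommGroup G] [AddCommGroup G']
    [AddCommGroup H] {S : AddSubgroup G} {S' : AddSubgroup G'} {h : G →+ H} {h' : G' →+ H}
    (hh : Function.Injective h) (hh' : Function.Injective h') (hS : S.map h = S'.map h') :
    ∃ e : S ≃+ S', ∀ s : S, h' (e s) = h s := by
  let e : S ≃+ S' := (S.equivMapOfInjective h hh).trans
    ((AddEquiv.addSubgroupCongr hS).trans (S'.equivMapOfInjective h' hh').symm)
  refine ⟨e, fun s => ?_⟩
  have := congrArg Subtype.val ((S'.equivMapOfInjective h' hh').apply_symm_apply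
    (AddEquiv.addSubgroupCongr hS (S.equivMapOfInjective h hh s)))
  exact this

/-- The restriction of `ratGradedMap` to the multiloop algebra. -/
noncomputable def multiloopRatMap (Z : CompatibleRoots k) (σ : Fin n → Aut k A)
    (m : Fin n → ℕ+) (φ : AlgIso k A A') (h : (Fin n → ℤ) →+ (Fin n → ℚ)) :
    multiloop Z σ m →ₗ[k] A' ⊗[k] AddMonoidAlgebra k (Fin n → ℚ) :=
  (ratGradedMap φ h).comp (multiloop Z σ m).toSubmodule.subtype

omit [IsScalarTower k A' A'] [SMulCommClass k A' A'] in
theorem multiloopRatMap_injective (Z : CompatibleRoots k) (σ : Fin n → Aut k A)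
    (m : Fin n → ℕ+) (φ : AlgIso k A A') {h : (Fin n → ℤ) →+ (Fin n → ℚ)}
    (hh : Function.Injective h) : Function.Injective (multiloopRatMap Z σ m φ h) :=
  (ratGradedMap_injective φ hh).comp (Submodule.subtype_injective _)

theorem multiloopRatMap_mul (Z : CompatibleRoots k) (σ : Fin n → Aut k A)
    (m : Fin n → ℕ+) (φ : AlgIso k A A') (h : (Fin n → ℤ) →+ (Fin n → ℚ))
    (x y : multiloop Z σ m) : multiloopRatMap Z σ m φ h (x * y) =
      multiloopRatMap Z σ m φ h x * multiloopRatMap Z σ m φ h y :=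
  ratGradedMap_mul _ _ _ _

omit [IsScalarTower k A' A'] [SMulCommClass k A' A'] in
theorem range_multiloopRatMap {Z : CompatibleRoots k} {σ : Fin n → Aut k A}
    {m : Fin n → ℕ+} {σ' : Fin n → Aut k A'} {φ : AlgIso k A A'}
    {h : (Fin n → ℤ) →+ (Fin n → ℚ)}
    (hE : ∀ l, (eigenspace Z σ m l).map φ.toLinearEquiv.toLinearMap = ratEigenspace Z σ' (h l))
    (hr : ∀ q ∉ Set.range h, ratEigenspace Z σ' q = ⊥) :
    LinearMap.range (multiloopRatMap Z σ m φ h) = ⨆ q, ratComponent Z σ' q := by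
  rw [← iSup_ratGradedMap_component hE hr, ← multiloop_toSubmodule, multiloopRatMap]
  exact LinearMap.range_domRestrict _ _

omit [IsScalarTower k A' A'] [SMulCommClass k A' A'] in
theorem map_grading_multiloopRatMap {Z : CompatibleRoots k} {σ : Fin n → Aut k A}
    {m : Fin n → ℕ+} {σ' : Fin n → Aut k A'} {φ : AlgIso k A A'}
    {h : (Fin n → ℤ) →+ (Fin n → ℚ)}
    (hE : ∀ l, (eigenspace Z σ m l).map φ.toLinearEquiv.toLinearMap = ratEigenspace Z σ' (h l))
    (l : Fin n → ℤ) :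
    (grading Z σ m l).map (multiloopRatMap Z σ m φ h) = ratComponent Z σ' (h l) := by
  rw [← ratGradedMap_map_component hE, ← grading_map_subtype, ← Submodule.map_comp]
  rfl

theorem exists_isSupportIso (Z : CompatibleRoots k) {σ : Fin n → Aut k A} {σ' : Fin n → Aut k A'}
    (hσ : ∀ i j, σ i * σ j = σ j * σ i) {m m' : Fin n → ℕ+}
    (hm : ∀ i, σ i ^ (m i : ℕ) = 1) (hm' : ∀ i, σ' i ^ (m' i : ℕ) = 1)
    (P : Matrix.GeneralLinearGroup (Fin n) ℤ) (φ : AlgIso k A A')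
    (hP : ∀ j, σ' j = conj φ (tuplePow σ P j)) :
    ∃ ψ : AlgIso k (multiloop Z σ m) (multiloop Z σ' m'),
      IsSupportIso (grading Z σ m) (grading Z σ' m') ψ ∧
      ∀ x : fixedPoints σ, (ψ (tmulOne Z σ m x) : A' ⊗[k] Laurent k n) =
        φ (x : A) ⊗ₜ[k] (1 : Laurent k n) := by
  have hE' : ∀ q, (ratEigenspace Z σ q).map φ.toLinearEquiv.toLinearMap =
      ratEigenspace Z σ' (ratVecMul P q) := fun q => by
    rw [← ratEigenspace_tuplePow Z hσ P q, map_ratEigenspace_conj, ← funext hP]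
  -- The twist by `P` is what makes `φ` carry the `l`-eigenspace of `σ` onto the `h l`-eigenspace of
  -- `σ'`.
  set h : (Fin n → ℤ) →+ (Fin n → ℚ) := (ratVecMul P).comp (ratIndex m) with h_def
  set h' : (Fin n → ℤ) →+ (Fin n → ℚ) := ratIndex m'
  have hh : Function.Injective h :=
    (Function.LeftInverse.injective (ratVecMul_inv P)).comp (ratIndex_injective m)
  have hh' : Function.Injective h' := ratIndex_injective m'
  have hE₁ : ∀ l, (eigenspace Z σ m l).map φ.toLinearEquiv.toLinearMap =
      ratEigenspace Z σ' (h l) := fun l => by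
    rw [eigenspace_eq_ratEigenspace, hE']; rfl
  have hE₂ : ∀ l, (eigenspace Z σ' m' l).map (AlgIso.refl : AlgIso k A' A').toLinearEquiv.toLinearMap
      = ratEigenspace Z σ' (h' l) := fun l => by
    rw [AlgIso.map_refl, eigenspace_eq_ratEigenspace]
  have hr₁ : ∀ q ∉ Set.range h, ratEigenspace Z σ' q = ⊥ := fun q hq => by
    rw [← ratVecMul_inv' P q, ← hE', ratEigenspace_eq_bot Z hm, Submodule.map_bot]
    rintro ⟨l, hl⟩
    exact hq ⟨l, by rw [h_def, AddMonoidHom.comp_apply, hl, ratVecMul_inv']⟩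
  have hr₂ : ∀ q ∉ Set.range h', ratEigenspace Z σ' q = ⊥ :=
    fun q hq => ratEigenspace_eq_bot Z hm' hq
  obtain ⟨ψ, hψ⟩ := AlgIso.exists_of_range_eq (multiloopRatMap_injective Z σ m φ hh)
    (multiloopRatMap_injective Z σ' m' AlgIso.refl hh') (multiloopRatMap_mul Z σ m φ h)
    (multiloopRatMap_mul Z σ' m' AlgIso.refl h')
    ((range_multiloopRatMap hE₁ hr₁).trans (range_multiloopRatMap hE₂ hr₂).symm)
  refine ⟨ψ, ?_, fun x => ?_⟩
  · obtain ⟨e, he⟩ := exists_addEquiv_of_map_eq (S := supportSpan (grading Z σ m))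
      (S' := supportSpan (grading Z σ' m')) hh hh' (by
        rw [supportSpan, supportSpan, AddMonoidHom.map_closure, AddMonoidHom.map_closure,
          image_support_grading hE₁ hr₁, image_support_grading hE₂ hr₂])
    refine ⟨e, fun l => ?_⟩
    -- Components can be compared inside `A' ⊗ k[ℚⁿ]`, where both become the same `ratComponent`.
    apply Submodule.map_injective_of_injective (multiloopRatMap_injective Z σ' m' AlgIso.refl hh')
    have hcomp : (multiloopRatMap Z σ' m' AlgIso.refl h').comp ψ.toLinearEquiv.toLinearMap =
        multiloopRatMap Z σ m φ h := LinearMap.ext hψ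
    rw [← Submodule.map_comp, map_grading_multiloopRatMap hE₂, he,
      ← map_grading_multiloopRatMap hE₁, ← hcomp]
  · apply ratGradedMap_injective AlgIso.refl hh'
    refine Eq.trans (hψ (tmulOne Z σ m x)) ?_
    change ratGradedMap φ h ((x : A) ⊗ₜ monomial k 0) =
      ratGradedMap AlgIso.refl h' (φ (x : A) ⊗ₜ monomial k 0)
    rw [ratGradedMap_tmul, ratGradedMap_tmul, map_zero, map_zero]; rfl

end Grading

/-! ### Diagonalization of commuting finite order automorphisms. -/

section Projections

/-- The idempotents of the group algebra of a cyclic group, evaluated at an element of order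
dividing `m`. -/
theorem exists_cyclic_idempotents {k R : Type*} [Field k] [CharZero k] [CommRing R] [Algebra k R]
    {m : ℕ} (hm : 0 < m) {ζ : k} (hζ : IsPrimitiveRoot ζ m) {r : R} (hr : r ^ m = 1) :
    ∃ p : ℕ → R, ∑ j ∈ Finset.range m, p j = 1 ∧ ∀ j, r * p j = ζ ^ j • p j := by
  have hm0 : (m : k) ≠ 0 := by exact_mod_cast hm.ne'
  have hζ0 : ζ ≠ 0 := hζ.ne_zero hm.ne'
  -- The discrete Fourier transform of the powers of `r`. Summed over `j`, the coefficient of `r ^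
  -- c` is a geometric sum that vanishes unless `c = 0`.
  refine ⟨fun j => (m : k)⁻¹ • ∑ c ∈ Finset.range m, (ζ⁻¹ ^ c) ^ j • r ^ c, ?_, fun j => ?_⟩
  · rw [← Finset.smul_sum, Finset.sum_comm]
    simp only [← Finset.sum_smul]
    rw [Finset.sum_eq_single_of_mem 0 (Finset.mem_range.2 hm)]
    · simp [smul_smul, hm0]
    · intro c hc hc0
      have h1 : ζ⁻¹ ^ c ≠ 1 :=
        hζ.inv.pow_ne_one_of_pos_of_lt hc0 (Finset.mem_range.1 hc)
      have h2 := geom_sum_eq h1 m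
      rw [h2, ← pow_mul, mul_comm, pow_mul, hζ.inv.pow_eq_one, one_pow, sub_self, zero_div,
        zero_smul]
  · rw [mul_smul_comm, smul_comm (ζ ^ j), Finset.mul_sum, Finset.smul_sum]
    have h1 : ∀ c, r * (ζ⁻¹ ^ c) ^ j • r ^ c = ζ ^ j • ((ζ⁻¹ ^ (c + 1)) ^ j • r ^ (c + 1)) := by
      intro c
      rw [smul_smul, mul_smul_comm, ← pow_succ', ← mul_pow, pow_succ ζ⁻¹, mul_comm (ζ⁻¹ ^ c),
        mul_inv_cancel_left₀ hζ0]
    simp only [h1]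
    rw [← Finset.smul_sum, ← Finset.smul_sum]
    congr 1
    -- Multiplication by `r` shifts the range to `1, …, m`; the terms at `0` and `m` agree because
    -- `r ^ m = 1` and `ζ ^ m = 1`.
    have h2 := Finset.sum_range_succ (fun c => (ζ⁻¹ ^ c) ^ j • r ^ c) m
    rw [Finset.sum_range_succ'] at h2
    refine congrArg _ ?_
    simpa [hr, hζ.pow_eq_one] using h2

variable {k A : Type*} [Field k] [CharZero k] [NonUnitalNonAssocRing A] [Module k A] {n : ℕ}

open scoped IsMulCommutative in
/-- Projections onto the simultaneous eigenspaces of a commuting tuple. -/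
theorem exists_projections (Z : CompatibleRoots k) {σ : Fin n → Aut k A}
    (hσ : ∀ i j, σ i * σ j = σ j * σ i) {m : Fin n → ℕ+} (hm : ∀ i, σ i ^ (m i : ℕ) = 1) :
    ∃ π : (Fin n → ℕ) → Module.End k A,
      (∀ u, ∑ l ∈ Fintype.piFinset fun i => Finset.range (m i), π l u = u) ∧
      (∀ l u, π l u ∈ eigenspace Z σ m fun i => l i) ∧
      ∀ i l u, σ i (π l u) = π l (σ i u) := by
  have hc : ∀ x ∈ Set.range fun i => AlgIso.autToEnd (σ i),
      ∀ y ∈ Set.range fun i => AlgIso.autToEnd (σ i), x * y = y * x := by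
    rintro _ ⟨i, rfl⟩ _ ⟨j, rfl⟩
    rw [← _root_.map_mul, ← _root_.map_mul, hσ i j]
  have := Algebra.isMulCommutative_adjoin k hc
  set R := Algebra.adjoin k (Set.range fun i => AlgIso.autToEnd (σ i))
  let s : Fin n → R := fun i => ⟨AlgIso.autToEnd (σ i), Algebra.subset_adjoin ⟨i, rfl⟩⟩
  have hs : ∀ i, s i ^ (m i : ℕ) = 1 := fun i => Subtype.ext (by
    change AlgIso.autToEnd (σ i) ^ (m i : ℕ) = 1
    rw [← map_pow, hm i, map_one])
  choose p hp₁ hp₂ using fun i =>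
    exists_cyclic_idempotents (R := R) (m i).pos (Z.primitive (m i)) (r := s i) (hs i)
  have happ : ∀ (a b : R) (u : A), (a * b : R).1 u = a.1 (b.1 u) := fun _ _ _ => rfl
  refine ⟨fun l => (∏ i, p i (l i) : R).1, fun u => ?_, fun l u i => ?_, fun i l u => ?_⟩
  -- Expanding the product over `i` of the resolutions `1 = ∑ⱼ pᵢ(j)` gives the joint resolution of
  -- the identity.
  · have h := Finset.prod_univ_sum (fun i => Finset.range (m i)) p
    simp only [hp₁, Finset.prod_const_one] at h
    have h' := congrArg (fun a : R => a.1 u) h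
    simpa using h'.symm
  · change (s i).1 ((∏ i, p i (l i) : R).1 u) = _
    have h : s i * ∏ i, p i (l i) = Z.ζ (m i) ^ l i • ∏ i, p i (l i) := by
      rw [← Finset.mul_prod_erase _ _ (Finset.mem_univ i), ← mul_assoc, hp₂ i, smul_mul_assoc]
    rw [← happ, h, zpow_natCast]
    rfl
  · change (s i).1 ((∏ i, p i (l i) : R).1 u) = (∏ i, p i (l i) : R).1 ((s i).1 u)
    rw [← happ, ← happ, mul_comm]

theorem iSup_eigenspace_eq_top (Z : CompatibleRoots k) {σ : Fin n → Aut k A}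
    (hσ : ∀ i j, σ i * σ j = σ j * σ i) {m : Fin n → ℕ+} (hm : ∀ i, σ i ^ (m i : ℕ) = 1) :
    ⨆ l, eigenspace Z σ m l = ⊤ := by
  obtain ⟨π, h₁, h₂, -⟩ := exists_projections Z hσ hm
  rw [eq_top_iff]
  intro u _
  rw [← h₁ u]
  exact Submodule.sum_mem _ fun l _ => Submodule.mem_iSup_of_mem _ (h₂ l u)

end Projections

/-! ### Periodicity of the eigenspaces. -/

section Eigenspaces

variable {k A : Type*} [Field k] [NonUnitalNonAssocRing A] [Module k A] {n : ℕ}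
  {Z : CompatibleRoots k} {σ : Fin n → Aut k A} {m : Fin n → ℕ+}

/-- The sublattice `m₁ℤ × ⋯ × mₙℤ`. -/
def periodLattice (m : Fin n → ℕ+) : AddSubgroup (Fin n → ℤ) where
  carrier := {l | ∀ i, (m i : ℤ) ∣ l i}
  add_mem' h h' i := dvd_add (h i) (h' i)
  zero_mem' _ := dvd_zero _
  neg_mem' h i := (h i).neg_right

theorem eigenspace_add_period (l : Fin n → ℤ) {g : Fin n → ℤ} (hg : g ∈ periodLattice m) :
    eigenspace Z σ m (l + g) = eigenspace Z σ m l := by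
  ext u
  have h : ∀ i, Z.ζ (m i) ^ (l + g) i = Z.ζ (m i) ^ l i := fun i => by
    rw [Pi.add_apply, zpow_add₀ (Z.ne_zero _),
      ((Z.primitive (m i)).zpow_eq_one_iff_dvd (g i)).2 (hg i), mul_one]
  simp only [mem_eigenspace, h]

theorem sub_mem_periodLattice {u : A} (hu : u ≠ 0) {l l' : Fin n → ℤ}
    (h : u ∈ eigenspace Z σ m l) (h' : u ∈ eigenspace Z σ m l') : l - l' ∈ periodLattice m := by
  intro i
  have h1 : (Z.ζ (m i) ^ l i - Z.ζ (m i) ^ l' i) • u = 0 := by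
    rw [sub_smul, ← h i, ← h' i, sub_self]
  have h2 := sub_eq_zero.1 ((smul_eq_zero.1 h1).resolve_right hu)
  apply ((Z.primitive (m i)).zpow_eq_one_iff_dvd _).1
  rw [Pi.sub_apply, zpow_sub₀ (Z.ne_zero _), h2, div_self (zpow_ne_zero _ (Z.ne_zero _))]

/-- Multiplication by `t^g`. -/
noncomputable def monomialMul (k A : Type*) [Field k] [NonUnitalNonAssocRing A] [Module k A]
    {n : ℕ} (g : Fin n → ℤ) : A ⊗[k] Laurent k n →ₗ[k] A ⊗[k] Laurent k n :=
  LinearMap.lTensor A (LinearMap.mulLeft k (monomial k g))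

theorem monomialMul_tmul (g l : Fin n → ℤ) (u : A) :
    monomialMul k A g (u ⊗ₜ monomial k l) = u ⊗ₜ monomial k (l + g) := by
  simp [monomialMul, monomial, AddMonoidAlgebra.single_mul_single, add_comm]

/-- Evaluation at `t = 1`. -/
noncomputable def evalOne (k A : Type*) [Field k] [NonUnitalNonAssocRing A] [Module k A] (n : ℕ) :
    A ⊗[k] Laurent k n →ₗ[k] A :=
  (TensorProduct.rid k A).toLinearMap ∘ₗ
    LinearMap.lTensor A (AddMonoidAlgebra.lift k k (Fin n → ℤ) 1).toLinearMap

theorem evalOne_tmul (u : A) (l : Fin n → ℤ) : evalOne k A n (u ⊗ₜ monomial k l) = u := by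
  simp [evalOne, monomial]

theorem mul_mem_eigenspace [IsScalarTower k A A] [SMulCommClass k A A] {l l' : Fin n → ℤ}
    {u v : A} (hu : u ∈ eigenspace Z σ m l) (hv : v ∈ eigenspace Z σ m l') :
    u * v ∈ eigenspace Z σ m (l + l') := fun i => by
  rw [AlgIso.map_mul, hu i, hv i, smul_mul_smul_comm, Pi.add_apply, zpow_add₀ (Z.ne_zero _)]

end Eigenspaces

/-! ### Centroidal maps and central-simple quotients. -/

section Centroid

variable {k A : Type*} [Field k] [NonUnitalNonAssocRing A] [Module k A]

theorem IsSimple.exists_ne_zero (hA : IsSimple k A) : ∃ u : A, u ≠ 0 := by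
  obtain ⟨x, y, h⟩ := hA.1
  exact ⟨x * y, h⟩

/-- The two-sided annihilator is an ideal, and it is not all of `A` because `A A ≠ 0`. -/
theorem IsSimple.eq_zero_of_annihilates [IsScalarTower k A A] [SMulCommClass k A A]
    (hA : IsSimple k A) {d : A} (hl : ∀ x, x * d = 0) (hr : ∀ x, d * x = 0) : d = 0 := by
  let I : Submodule k A :=
    { carrier := {d | ∀ x, x * d = 0 ∧ d * x = 0}
      add_mem' := fun h h' x => by simp [mul_add, add_mul, h x, h' x]
      zero_mem' := fun x => by simp
      smul_mem' := fun c d h x => by simp [mul_smul_comm, smul_mul_assoc, h x] }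
  have hI : IsIdeal I := fun a x hx => by
    rw [(hx a).1, (hx a).2]; exact ⟨I.zero_mem, I.zero_mem⟩
  have hd : d ∈ I := fun x => ⟨hl x, hr x⟩
  rcases hA.2 I hI with h | h
  · rwa [h, Submodule.mem_bot] at hd
  · obtain ⟨x, y, hxy⟩ := hA.1
    have hy : y ∈ I := h ▸ Submodule.mem_top
    exact absurd (hy x).1 hxy

/-- A surjection onto a central-simple algebra turns centroidal maps into scalars. -/
theorem IsCentralSimple.exists_scalar [IsScalarTower k A A] [SMulCommClass k A A]
    (hA : IsCentralSimple k A) {B : Type*} [NonUnitalNonAssocRing B] [Module k B]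
    (f : B →ₗ[k] A) (hf : Function.Surjective f) (hmul : ∀ x y, f (x * y) = f x * f y)
    (T : B →ₗ[k] B) (hT : ∀ x y, T (x * y) = x * T y ∧ T (x * y) = T x * y) :
    ∃ c : k, ∀ x, f (T x) = c • f x := by
  -- `T` preserves the kernel of `f`: moving `T` to the other factor shows that `f (T b)`
  -- annihilates `A` on both sides.
  have hker : ∀ b, f b = 0 → f (T b) = 0 := fun b hb => by
    refine hA.1.eq_zero_of_annihilates (fun a => ?_) (fun a => ?_) <;> obtain ⟨x, rfl⟩ := hf a
    · rw [← hmul, ← (hT x b).1, (hT x b).2, hmul, hb, mul_zero]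
    · rw [← hmul, ← (hT b x).2, (hT b x).1, hmul, hb, zero_mul]
  -- With a linear section `g`, the map `f ∘ T ∘ g` is the endomorphism of `A` induced by `T`; it
  -- lies in the centroid.
  obtain ⟨g, hg⟩ := f.exists_rightInverse_of_surjective (LinearMap.range_eq_top.2 hf)
  have hg : ∀ a, f (g a) = a := fun a => LinearMap.congr_fun hg a
  have hfT : ∀ x, f (T (g (f x))) = f (T x) := fun x => by
    have := hker (g (f x) - x) (by rw [map_sub, hg, sub_self])
    rwa [map_sub, map_sub, sub_eq_zero] at this
  have hc : f ∘ₗ T ∘ₗ g ∈ centroid k A := by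
    intro a a'
    obtain ⟨x, rfl⟩ := hf a
    obtain ⟨y, rfl⟩ := hf a'
    simp only [LinearMap.comp_apply, ← hmul, hfT]
    exact ⟨by rw [(hT x y).1], by rw [(hT x y).2]⟩
  rw [hA.2, Algebra.mem_bot] at hc
  obtain ⟨c, hc⟩ := hc
  refine ⟨c, fun x => ?_⟩
  rw [← hfT x]
  exact (LinearMap.congr_fun hc (f x)).symm

end Centroid

/-! ### Homomorphisms from the multiloop algebra onto a central-simple algebra. -/

section Evaluation

variable {k A A' : Type*} [Field k] [NonUnitalNonAssocRing A] [Module k A]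
  [IsScalarTower k A A] [SMulCommClass k A A] [NonUnitalNonAssocRing A'] [Module k A']
  [IsScalarTower k A' A'] [SMulCommClass k A' A'] {n : ℕ}

theorem monomialMul_mul (g : Fin n → ℤ) (x y : A ⊗[k] Laurent k n) :
    monomialMul k A g (x * y) = x * monomialMul k A g y ∧
      monomialMul k A g (x * y) = monomialMul k A g x * y := by
  induction x using TensorProduct.induction_on with
  | zero => simp
  | add x x' hx hx' =>
    rw [add_mul, map_add, map_add, add_mul, add_mul]
    exact ⟨by rw [hx.1, hx'.1], by rw [hx.2, hx'.2]⟩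
  | tmul u a =>
    induction y using TensorProduct.induction_on with
    | zero => simp
    | add y y' hy hy' =>
      rw [mul_add, map_add, map_add, mul_add, mul_add]
      exact ⟨by rw [hy.1, hy'.1], by rw [hy.2, hy'.2]⟩
    | tmul v b => simp [monomialMul, mul_assoc, mul_left_comm]

theorem monomialMul_mem {Z : CompatibleRoots k} {σ : Fin n → Aut k A} {m : Fin n → ℕ+}
    {g : Fin n → ℤ} (hg : g ∈ periodLattice m) {x : A ⊗[k] Laurent k n}
    (hx : x ∈ (multiloop Z σ m).toSubmodule) :
    monomialMul k A g x ∈ (multiloop Z σ m).toSubmodule := by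
  suffices h : (multiloop Z σ m).toSubmodule ≤
      (multiloop Z σ m).toSubmodule.comap (monomialMul k A g) from h hx
  conv_lhs => rw [multiloop_toSubmodule]
  refine iSup_le fun l => ?_
  rintro _ ⟨u, hu, rfl⟩
  refine component_le Z σ m (l + g) ⟨u, ?_, (monomialMul_tmul g l u).symm⟩
  rw [eigenspace_add_period l hg]; exact hu

theorem tmul_mem_multiloop {Z : CompatibleRoots k} {σ : Fin n → Aut k A} {m : Fin n → ℕ+}
    {l : Fin n → ℤ} {u : A} (hu : u ∈ eigenspace Z σ m l) :
    u ⊗ₜ monomial k l ∈ (multiloop Z σ m).toSubmodule := component_le Z σ m l ⟨u, hu, rfl⟩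

/-- A homomorphism from the multiloop algebra onto `A'`, extended linearly to `A ⊗ k[ℤⁿ]`. -/
structure IsSpecialization (Z : CompatibleRoots k) (σ : Fin n → Aut k A) (m : Fin n → ℕ+)
    (f : A ⊗[k] Laurent k n →ₗ[k] A') : Prop where
  map_mul : ∀ x ∈ (multiloop Z σ m).toSubmodule, ∀ y ∈ (multiloop Z σ m).toSubmodule,
    f (x * y) = f x * f y
  surjective : (multiloop Z σ m).toSubmodule.map f = ⊤

variable {Z : CompatibleRoots k} {σ : Fin n → Aut k A} {m : Fin n → ℕ+}
  {f : A ⊗[k] Laurent k n →ₗ[k] A'}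

/-- Multiplication by `t^g` preserves the multiloop algebra, since eigenspaces are periodic, and
commutes with its multiplications. `IsCentralSimple.exists_scalar` therefore applies. -/
theorem IsSpecialization.exists_scalar (hf : IsSpecialization Z σ m f)
    (hA' : IsCentralSimple k A') {g : Fin n → ℤ} (hg : g ∈ periodLattice m) :
    ∃ c : k, c ≠ 0 ∧ ∀ l, ∀ u ∈ eigenspace Z σ m l,
      f (u ⊗ₜ monomial k (l + g)) = c • f (u ⊗ₜ monomial k l) := by
  have hsurj : Function.Surjective (f.comp (multiloop Z σ m).toSubmodule.subtype) := fun a => by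
    have : a ∈ (multiloop Z σ m).toSubmodule.map f := hf.surjective ▸ Submodule.mem_top
    obtain ⟨x, hx, rfl⟩ := this
    exact ⟨⟨x, hx⟩, rfl⟩
  let T : multiloop Z σ m →ₗ[k] multiloop Z σ m :=
    (monomialMul k A g).restrict (p := (multiloop Z σ m).toSubmodule) fun x hx =>
      monomialMul_mem hg hx
  obtain ⟨c, hc⟩ := hA'.exists_scalar (B := multiloop Z σ m)
    (f.comp (multiloop Z σ m).toSubmodule.subtype) hsurj
    (fun x y => hf.map_mul x x.2 y y.2) T (fun x y =>
      ⟨Subtype.ext (monomialMul_mul g x.1 y.1).1, Subtype.ext (monomialMul_mul g x.1 y.1).2⟩)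
  have key : ∀ l, ∀ u ∈ eigenspace Z σ m l,
      f (u ⊗ₜ monomial k (l + g)) = c • f (u ⊗ₜ monomial k l) := fun l u hu => by
    rw [← monomialMul_tmul]
    exact hc ⟨u ⊗ₜ monomial k l, tmul_mem_multiloop hu⟩
  refine ⟨c, ?_, key⟩
  rintro rfl
  obtain ⟨a, ha⟩ := hA'.1.exists_ne_zero
  -- Every component is a `t^g`-translate of another one, so `c = 0` would make `f` vanish on the
  -- multiloop algebra.
  have h0 : (multiloop Z σ m).toSubmodule.map f ≤ ⊥ := by
    rw [multiloop_toSubmodule, Submodule.map_iSup]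
    refine iSup_le fun l => ?_
    rintro _ ⟨_, ⟨u, hu, rfl⟩, rfl⟩
    have := key (l - g) u (by rwa [sub_eq_add_neg, eigenspace_add_period l (neg_mem hg)])
    rw [sub_add_cancel, zero_smul] at this
    exact this
  rw [hf.surjective] at h0
  exact ha ((Submodule.mem_bot k).1 (h0 Submodule.mem_top))

theorem evalOne_mul (x y : A ⊗[k] Laurent k n) :
    evalOne k A n (x * y) = evalOne k A n x * evalOne k A n y := by
  induction x using TensorProduct.induction_on with
  | zero => simp
  | add x x' hx hx' => rw [add_mul, map_add, map_add, add_mul, hx, hx']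
  | tmul u a =>
    induction y using TensorProduct.induction_on with
    | zero => simp
    | add y y' hy hy' => rw [mul_add, map_add, map_add, mul_add, hy, hy']
    | tmul v b => simp [evalOne, smul_mul_smul_comm]

end Evaluation

/-! ### Integral matrices from isomorphisms preserving period lattices. -/

section Lattices

variable {n : ℕ} {m m' : Fin n → ℕ+}

theorem single_mem_periodLattice (i : Fin n) : Pi.single i (m i : ℤ) ∈ periodLattice m := by
  intro j
  rcases eq_or_ne j i with rfl | h
  · rw [Pi.single_eq_same]
  · rw [Pi.single_eq_of_ne h]; exact dvd_zero _

theorem ratIndex_single (i : Fin n) : ratIndex m (Pi.single i (m i : ℤ)) = Pi.single i 1 := by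
  have hm : ((m i : ℕ) : ℚ) ≠ 0 := by exact_mod_cast (m i).ne_zero
  ext j
  rw [ratIndex_apply]
  rcases eq_or_ne j i with rfl | h
  · rw [Pi.single_eq_same, Pi.single_eq_same]; push_cast; exact div_self hm
  · rw [Pi.single_eq_of_ne h, Pi.single_eq_of_ne h]; simp

/-- In rational coordinates both period lattices are `ℤⁿ`, so the images of the basis vectors `mᵢ
eᵢ` are the rows of an integral matrix. The formula extends to `S` because a positive multiple of
each element lies in the lattice and `ℚⁿ` is torsion-free. -/
theorem exists_intMatrix {S S' : AddSubgroup (Fin n → ℤ)} (e : S →+ S')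
    (hS : periodLattice m ≤ S)
    (he : ∀ s : S, (s : Fin n → ℤ) ∈ periodLattice m → (e s : Fin n → ℤ) ∈ periodLattice m') :
    ∃ M : Matrix (Fin n) (Fin n) ℤ, ∀ s : S, ratIndex m' (e s) =
      Matrix.vecMul (ratIndex m s) (M.map (Int.castRingHom ℚ)) := by
  let p : Fin n → S := fun i => ⟨Pi.single i (m i : ℤ), hS (single_mem_periodLattice i)⟩
  choose M hM using fun i => he (p i) (single_mem_periodLattice i)
  let F : S →+ (Fin n → ℚ) := (ratIndex m').comp (S'.subtype.comp e)
  have hF : ∀ i, F (p i) = fun j => (M i j : ℚ) := fun i => by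
    ext j
    have hm : ((m' j : ℕ) : ℚ) ≠ 0 := by exact_mod_cast (m' j).ne_zero
    change ((e (p i) : Fin n → ℤ) j : ℚ) / m' j = M i j
    rw [hM i j]; push_cast; field_simp
  refine ⟨Matrix.of M, fun s => ?_⟩
  choose c hc using fun i => Finset.dvd_prod_of_mem (fun i => (m i : ℕ)) (Finset.mem_univ i)
  set K : ℕ := ∏ i, (m i : ℕ)
  have hK : (K : ℚ) ≠ 0 := by
    exact Nat.cast_ne_zero.2 (Finset.prod_ne_zero_iff.2 fun i _ => (m i).ne_zero)
  -- Here `K = mᵢ cᵢ` for every `i`, so `K` carries `S` into the period lattice.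
  have hs : K • s = ∑ i, ((c i : ℤ) * (s : Fin n → ℤ) i) • p i := by
    apply Subtype.ext
    rw [AddSubgroup.coe_nsmul, AddSubgroup.val_finsetSum]
    ext j
    rw [Finset.sum_apply, Finset.sum_eq_single_of_mem j (Finset.mem_univ j)]
    · change K • (s : Fin n → ℤ) j =
        ((c j : ℤ) * (s : Fin n → ℤ) j) • (Pi.single j (m j : ℤ) : Fin n → ℤ) j
      rw [Pi.single_eq_same, hc j, nsmul_eq_mul, smul_eq_mul]; push_cast; ring
    · intro i _ hij
      change ((c i : ℤ) * (s : Fin n → ℤ) i) • (Pi.single i (m i : ℤ) : Fin n → ℤ) j = 0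
      rw [Pi.single_eq_of_ne hij.symm, smul_zero]
  have h := congrArg F hs
  rw [map_nsmul, map_sum] at h
  simp only [map_zsmul, hF] at h
  ext j
  have hj := congrFun h j
  rw [Finset.sum_apply] at hj
  change ((ratIndex m') (e s)) j = _
  change K • (ratIndex m' (e s)) j = ∑ i, ((c i : ℤ) * (s : Fin n → ℤ) i) • (M i j : ℚ) at hj
  rw [nsmul_eq_mul] at hj
  apply mul_left_cancel₀ hK
  rw [hj, Matrix.vecMul, dotProduct, Finset.mul_sum]
  refine Finset.sum_congr rfl fun i _ => ?_
  have hm : ((m i : ℕ) : ℚ) ≠ 0 := by exact_mod_cast (m i).ne_zero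
  have hci : (K : ℚ) = (m i : ℕ) * c i := by exact_mod_cast hc i
  rw [ratIndex_apply, hci, zsmul_eq_mul, Matrix.map_apply, Matrix.of_apply,
    eq_intCast]
  push_cast
  field_simp

theorem intMatrix_mul_eq_one {S S' : AddSubgroup (Fin n → ℤ)} (e : S ≃+ S')
    (hS : periodLattice m ≤ S) {M N : Matrix (Fin n) (Fin n) ℤ}
    (hM : ∀ s : S, ratIndex m' (e s) =
      Matrix.vecMul (ratIndex m s) (M.map (Int.castRingHom ℚ)))
    (hN : ∀ s : S', ratIndex m (e.symm s) =
      Matrix.vecMul (ratIndex m' s) (N.map (Int.castRingHom ℚ))) : M * N = 1 := by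
  apply Matrix.map_injective (RingHom.injective_int (Int.castRingHom ℚ))
  refine Matrix.ext_of_single_vecMul fun i => ?_
  change Matrix.vecMul _ ((M * N).map (Int.castRingHom ℚ)) =
    Matrix.vecMul _ ((1 : Matrix (Fin n) (Fin n) ℤ).map (Int.castRingHom ℚ))
  rw [Matrix.map_mul, ← Matrix.vecMul_vecMul, ← ratIndex_single (m := m)]
  have h := hM ⟨_, hS (single_mem_periodLattice i)⟩
  rw [← h, ← hN, AddEquiv.symm_apply_apply]
  simp

theorem exists_generalLinear {S S' : AddSubgroup (Fin n → ℤ)} (e : S ≃+ S')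
    (hS : periodLattice m ≤ S) (hS' : periodLattice m' ≤ S')
    (he : ∀ s : S, (s : Fin n → ℤ) ∈ periodLattice m → (e s : Fin n → ℤ) ∈ periodLattice m')
    (he' : ∀ s : S', (s : Fin n → ℤ) ∈ periodLattice m' →
      (e.symm s : Fin n → ℤ) ∈ periodLattice m) :
    ∃ P : Matrix.GeneralLinearGroup (Fin n) ℤ, ∀ s : S,
      ratIndex m' (e s) = ratVecMul P (ratIndex m s) := by
  obtain ⟨M, hM⟩ := exists_intMatrix e.toAddMonoidHom hS he
  obtain ⟨N, hN⟩ := exists_intMatrix e.symm.toAddMonoidHom hS' he'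
  exact ⟨⟨M, N, intMatrix_mul_eq_one e hS hM hN, intMatrix_mul_eq_one e.symm hS' hN hM⟩, hM⟩

end Lattices

/-! ### Untwisting a specialization into an isomorphism. -/

section SpecializationIso

variable {k A A' : Type*} [Field k] [NonUnitalNonAssocRing A] [Module k A]
  [IsScalarTower k A A] [SMulCommClass k A A] [NonUnitalNonAssocRing A'] [Module k A']
  [IsScalarTower k A' A'] [SMulCommClass k A' A'] {n : ℕ}
  {Z : CompatibleRoots k} {σ : Fin n → Aut k A} {m : Fin n → ℕ+}
  {f : A ⊗[k] Laurent k n →ₗ[k] A'}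

theorem prod_zpow_add {b : Fin n → k} (hb : ∀ i, b i ≠ 0) (l l' : Fin n → ℤ) :
    ∏ i, b i ^ (l + l') i = (∏ i, b i ^ l i) * ∏ i, b i ^ l' i := by
  rw [← Finset.prod_mul_distrib]
  exact Finset.prod_congr rfl fun i _ => zpow_add₀ (hb i) _ _

theorem prod_zpow_ne_zero {b : Fin n → k} (hb : ∀ i, b i ≠ 0) (l : Fin n → ℤ) :
    ∏ i, b i ^ l i ≠ 0 := Finset.prod_ne_zero_iff.2 fun i _ => zpow_ne_zero _ (hb i)

/-- Choosing `bᵢ` as an `mᵢ`-th root of the scalar for `mᵢ eᵢ` extends the character of the period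
lattice to `ℤⁿ`. The degrees where the formula holds form a subgroup, so the generators suffice. -/
theorem IsSpecialization.exists_character [IsAlgClosed k] (hf : IsSpecialization Z σ m f)
    (hA' : IsCentralSimple k A') :
    ∃ b : Fin n → k, (∀ i, b i ≠ 0) ∧ ∀ g ∈ periodLattice m, ∀ l, ∀ u ∈ eigenspace Z σ m l,
      f (u ⊗ₜ monomial k (l + g)) = (∏ i, b i ^ g i) • f (u ⊗ₜ monomial k l) := by
  choose c hc0 hc using fun i => hf.exists_scalar hA' (single_mem_periodLattice i)
  choose b hbc using fun i => IsAlgClosed.exists_pow_nat_eq (c i) (m i).pos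
  have hb : ∀ i, b i ≠ 0 := fun i h => hc0 i (by rw [← hbc i, h, zero_pow (m i).ne_zero])
  refine ⟨b, hb, fun g hg => ?_⟩
  let S : AddSubgroup (Fin n → ℤ) :=
    { carrier := {g | g ∈ periodLattice m ∧ ∀ l, ∀ u ∈ eigenspace Z σ m l,
        f (u ⊗ₜ monomial k (l + g)) = (∏ i, b i ^ g i) • f (u ⊗ₜ monomial k l)}
      add_mem' := fun {g g'} h h' => ⟨add_mem h.1 h'.1, fun l u hu => by
        rw [← add_assoc, h'.2 _ u (by rwa [eigenspace_add_period l h.1]), h.2 l u hu, smul_smul,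
          prod_zpow_add hb, mul_comm]⟩
      zero_mem' := ⟨zero_mem _, fun l u _ => by simp⟩
      neg_mem' := fun {g} h => ⟨neg_mem h.1, fun l u hu => by
        have h1 := h.2 (l + -g) u (by rwa [eigenspace_add_period l (neg_mem h.1)])
        rw [neg_add_cancel_right] at h1
        rw [h1, smul_smul, ← prod_zpow_add hb, neg_add_cancel]
        simp⟩ }
  have hS : ∀ i, Pi.single i (m i : ℤ) ∈ S := fun i =>
    ⟨single_mem_periodLattice i, fun l u hu => by
      rw [hc i l u hu, ← hbc i, Finset.prod_eq_single i]
      · simp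
      · intro j _ hj; rw [Pi.single_eq_of_ne hj, zpow_zero]
      · simp⟩
  choose d hd using hg
  have hgS : g ∈ S := by
    have : g = ∑ i, d i • Pi.single i (m i : ℤ) := by
      ext j
      rw [Finset.sum_apply, Finset.sum_eq_single_of_mem j (Finset.mem_univ j)]
      · rw [Pi.smul_apply, Pi.single_eq_same, hd j, smul_eq_mul, mul_comm]
      · intro i _ hij; rw [Pi.smul_apply, Pi.single_eq_of_ne hij.symm, smul_zero]
    rw [this]
    exact sum_mem fun i _ => zsmul_mem (hS i) _
  exact hgS.2

omit [IsScalarTower k A A] [SMulCommClass k A A]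
  [IsScalarTower k A' A'] [SMulCommClass k A' A'] in
/-- A linear map that is multiplicative on simultaneous eigenvectors is multiplicative. -/
theorem map_mul_of_eigenspace (htop : ⨆ l, eigenspace Z σ m l = ⊤) (φ : A →ₗ[k] A')
    (h : ∀ l, ∀ u ∈ eigenspace Z σ m l, ∀ l', ∀ v ∈ eigenspace Z σ m l',
      φ (u * v) = φ u * φ v) (x y : A) : φ (x * y) = φ x * φ y := by
  have hx : x ∈ ⨆ l, eigenspace Z σ m l := htop ▸ Submodule.mem_top
  have hy : y ∈ ⨆ l, eigenspace Z σ m l := htop ▸ Submodule.mem_top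
  induction hx using Submodule.iSup_induction' with
  | zero => simp
  | add x x' _ _ h h' => rw [add_mul, map_add, map_add, add_mul, h, h']
  | mem l u hu =>
    induction hy using Submodule.iSup_induction' with
    | zero => simp
    | add y y' _ _ h h' => rw [mul_add, map_add, map_add, mul_add, h, h']
    | mem l' v hv => exact h l u hu l' v hv

theorem IsSpecialization.exists_algIso [CharZero k] [IsAlgClosed k]
    (hf : IsSpecialization Z σ m f) (hA : IsSimple k A) (hA' : IsCentralSimple k A')
    (hσ : ∀ i j, σ i * σ j = σ j * σ i) (hm : ∀ i, σ i ^ (m i : ℕ) = 1) :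
    ∃ φ : AlgIso k A A', ∀ l, ∃ c : k, ∀ u ∈ eigenspace Z σ m l,
      φ u = c • f (u ⊗ₜ monomial k l) := by
  obtain ⟨b, hb, hbf⟩ := hf.exists_character hA'
  obtain ⟨π, hπ₁, hπ₂, hπ₃⟩ := exists_projections Z hσ hm
  have htop := iSup_eigenspace_eq_top Z hσ hm
  -- One representative per residue class modulo `m`: each eigencomponent is placed in that degree,
  -- sent through `f` and divided by `b^l`.
  let φ : A →ₗ[k] A' := ∑ l ∈ Fintype.piFinset fun i => Finset.range (m i),
    (∏ i, b i ^ ((fun i => (l i : ℤ)) i))⁻¹ •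
      (f ∘ₗ (TensorProduct.mk k A (Laurent k n)).flip (monomial k fun i => (l i : ℤ)) ∘ₗ π l)
  have hφ : ∀ l, ∀ u ∈ eigenspace Z σ m l,
      φ u = (∏ i, b i ^ l i)⁻¹ • f (u ⊗ₜ monomial k l) := by
    intro l u hu
    conv_rhs => rw [← hπ₁ u, TensorProduct.sum_tmul, map_sum, Finset.smul_sum]
    rw [LinearMap.sum_apply]
    refine Finset.sum_congr rfl fun d _ => ?_
    rw [LinearMap.smul_apply]
    change _ • f (π d u ⊗ₜ monomial k fun i => (d i : ℤ)) = _
    rcases eq_or_ne (π d u) 0 with h0 | h0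
    · simp [h0]
    -- A nonzero `π d u` lies in the eigenspaces of both `d` and `l`, so `l - d` is a period and
    -- `b^{l-d}` accounts exactly for the change of representative.
    · have hl : π d u ∈ eigenspace Z σ m l := fun i => by
        rw [hπ₃, hu i, map_smul]
      have hg := sub_mem_periodLattice h0 (hπ₂ d u) hl
      have h1 := hbf _ hg l _ hl
      rw [add_sub_cancel] at h1
      rw [h1, smul_smul]
      congr 1
      rw [inv_mul_eq_iff_eq_mul₀ (prod_zpow_ne_zero hb _),
        eq_mul_inv_iff_mul_eq₀ (prod_zpow_ne_zero hb _), ← prod_zpow_add hb, sub_add_cancel]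
  have hmul : ∀ x y, φ (x * y) = φ x * φ y := by
    refine map_mul_of_eigenspace htop φ fun l u hu l' v hv => ?_
    rw [hφ l u hu, hφ l' v hv, hφ _ _ (mul_mem_eigenspace hu hv), smul_mul_smul_comm,
      ← hf.map_mul _ (tmul_mem_multiloop hu) _ (tmul_mem_multiloop hv), prod_zpow_add hb, mul_inv]
    simp [monomial, AddMonoidAlgebra.single_mul_single]
  have hsurj : LinearMap.range φ = ⊤ := by
    rw [eq_top_iff, ← hf.surjective, multiloop_toSubmodule, Submodule.map_iSup]
    refine iSup_le fun l => ?_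
    rintro _ ⟨_, ⟨u, hu, rfl⟩, rfl⟩
    refine ⟨(∏ i, b i ^ l i) • u, ?_⟩
    rw [map_smul, hφ l u hu, smul_smul, mul_inv_cancel₀ (prod_zpow_ne_zero hb _), one_smul]
    rfl
  have hinj : LinearMap.ker φ = ⊥ := by
    refine (hA.2 (LinearMap.ker φ) fun a x hx => ?_).resolve_right fun h => ?_
    · rw [LinearMap.mem_ker] at hx ⊢
      rw [LinearMap.mem_ker, hmul, hmul, hx, mul_zero, zero_mul]
      exact ⟨rfl, rfl⟩
    · obtain ⟨a, ha⟩ := hA'.1.exists_ne_zero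
      obtain ⟨x, rfl⟩ := LinearMap.range_eq_top.1 hsurj a
      exact ha (LinearMap.mem_ker.1 (h ▸ Submodule.mem_top : x ∈ LinearMap.ker φ))
  exact ⟨AlgIso.ofBijective φ ⟨LinearMap.ker_eq_bot.1 hinj, LinearMap.range_eq_top.1 hsurj⟩ hmul,
    fun l => ⟨_, hφ l⟩⟩

end SpecializationIso

/-! ### From a support-isomorphism to a conjugacy. -/

section SupportIso

variable {k A A' : Type*} [Field k] [CharZero k] [NonUnitalNonAssocRing A] [Module k A]
  [IsScalarTower k A A] [SMulCommClass k A A] [NonUnitalNonAssocRing A'] [Module k A']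
  [IsScalarTower k A' A'] [SMulCommClass k A' A'] {n : ℕ}
  {Z : CompatibleRoots k} {σ : Fin n → Aut k A} {m : Fin n → ℕ+}
  {σ' : Fin n → Aut k A'} {m' : Fin n → ℕ+}

omit [IsScalarTower k A A] [SMulCommClass k A A] in
theorem exists_eigenvector (hA : IsSimple k A)
    (hσ : ∀ i j, σ i * σ j = σ j * σ i) (hm : ∀ i, σ i ^ (m i : ℕ) = 1) :
    ∃ l, ∃ u ∈ eigenspace Z σ m l, u ≠ 0 := by
  by_contra! h
  obtain ⟨a, ha⟩ := hA.exists_ne_zero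
  have : ⨆ l, eigenspace Z σ m l ≤ ⊥ := iSup_le fun l u hu => (Submodule.mem_bot k).2 (h l u hu)
  rw [iSup_eigenspace_eq_top Z hσ hm] at this
  exact ha ((Submodule.mem_bot k).1 (this Submodule.mem_top))

omit [CharZero k] in
theorem mem_supportSpan_of_mem {l : Fin n → ℤ} {u : A} (hu : u ∈ eigenspace Z σ m l)
    (h0 : u ≠ 0) : l ∈ supportSpan (grading Z σ m) :=
  AddSubgroup.subset_closure
    (mem_support_grading.2 fun h => h0 (by rwa [h, Submodule.mem_bot] at hu))

/-- A nonzero eigenvector of degree `l` also has degree `l + g`, so `g` is a difference of two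
support elements. -/
theorem periodLattice_le_supportSpan (hA : IsSimple k A)
    (hσ : ∀ i j, σ i * σ j = σ j * σ i) (hm : ∀ i, σ i ^ (m i : ℕ) = 1) :
    periodLattice m ≤ supportSpan (grading Z σ m) := by
  obtain ⟨l, u, hu, h0⟩ := exists_eigenvector (Z := Z) hA hσ hm
  intro g hg
  have h1 : u ∈ eigenspace Z σ m (l + g) := by rwa [eigenspace_add_period l hg]
  simpa using sub_mem (mem_supportSpan_of_mem h1 h0) (mem_supportSpan_of_mem hu h0)

theorem exists_isSpecialization {ψ : AlgIso k (multiloop Z σ m) (multiloop Z σ' m')}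
    {e : supportSpan (grading Z σ m) ≃+ supportSpan (grading Z σ' m')}
    (he : ∀ l : supportSpan (grading Z σ m), (grading Z σ m l).map ψ.toLinearEquiv.toLinearMap =
      grading Z σ' m' (e l))
    (hσ' : ∀ i j, σ' i * σ' j = σ' j * σ' i) (hm' : ∀ i, σ' i ^ (m' i : ℕ) = 1) :
    ∃ f : A ⊗[k] Laurent k n →ₗ[k] A', IsSpecialization Z σ m f ∧
      ∀ l : supportSpan (grading Z σ m), ∀ u ∈ eigenspace Z σ m l,
        f (u ⊗ₜ monomial k (l : Fin n → ℤ)) ∈ eigenspace Z σ' m' (e l) ∧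
        (f (u ⊗ₜ monomial k (l : Fin n → ℤ)) = 0 → u = 0) := by
  -- `f` is `ψ` followed by evaluation at `t = 1`; its values off the multiloop algebra are
  -- arbitrary and never matter. Evaluation is injective on a single component, whence the last
  -- claim.
  obtain ⟨f, hf⟩ := LinearMap.exists_extend (p := (multiloop Z σ m).toSubmodule)
    (evalOne k A' n ∘ₗ (multiloop Z σ' m').toSubmodule.subtype ∘ₗ ψ.toLinearEquiv.toLinearMap)
  have hf : ∀ x : multiloop Z σ m, f x = evalOne k A' n (ψ x) := fun x => LinearMap.congr_fun hf x
  refine ⟨f, ⟨fun x hx y hy => ?_, ?_⟩, fun l u hu => ?_⟩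
  · refine (hf (⟨x, hx⟩ * ⟨y, hy⟩)).trans ?_
    rw [hf ⟨x, hx⟩, hf ⟨y, hy⟩, ← evalOne_mul, AlgIso.map_mul]
    rfl
  · rw [eq_top_iff, ← iSup_eigenspace_eq_top Z hσ' hm']
    refine iSup_le fun l v hv => ?_
    let y : multiloop Z σ' m' := ⟨v ⊗ₜ monomial k l, tmul_mem_multiloop hv⟩
    refine ⟨ψ.symm y, (ψ.symm y).2, ?_⟩
    rw [hf, AlgIso.self_apply_symm, evalOne_tmul]
  · let x : multiloop Z σ m := ⟨u ⊗ₜ monomial k (l : Fin n → ℤ), tmul_mem_multiloop hu⟩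
    have hx : ψ x ∈ grading Z σ' m' (e l) := by
      rw [← he l]; exact ⟨x, ⟨u, hu, rfl⟩, rfl⟩
    obtain ⟨v, hv, hvx⟩ := hx
    have hfv : f (u ⊗ₜ monomial k (l : Fin n → ℤ)) = v := by
      rw [show u ⊗ₜ monomial k (l : Fin n → ℤ) = (x : A ⊗[k] Laurent k n) from rfl, hf, ← hvx]
      exact evalOne_tmul v _
    refine ⟨hfv ▸ hv, fun h0 => ?_⟩
    have h1 : ψ x = 0 := Subtype.ext (by
      rw [← hvx, ← hfv, h0]; exact map_zero _)
    have h2 : x = 0 := ψ.toLinearEquiv.map_eq_zero_iff.1 h1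
    exact tmul_monomial_eq_zero.1 (congrArg Subtype.val h2)

/-- For an eigenvector `u ≠ 0` of degree `l`, the nonzero vector `f(u ⊗ t^{l+g})` lies in the
eigenspace of degree `e(l+g)`, and, being a multiple of `f(u ⊗ t^l)`, also in that of degree `e(l)`.
Thus `e(g)` is a period. -/
theorem map_periodLattice {ψ : AlgIso k (multiloop Z σ m) (multiloop Z σ' m')}
    {e : supportSpan (grading Z σ m) ≃+ supportSpan (grading Z σ' m')}
    (he : ∀ l : supportSpan (grading Z σ m), (grading Z σ m l).map ψ.toLinearEquiv.toLinearMap =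
      grading Z σ' m' (e l)) (hA : IsSimple k A) (hA' : IsCentralSimple k A')
    (hσ : ∀ i j, σ i * σ j = σ j * σ i) (hm : ∀ i, σ i ^ (m i : ℕ) = 1)
    (hσ' : ∀ i j, σ' i * σ' j = σ' j * σ' i) (hm' : ∀ i, σ' i ^ (m' i : ℕ) = 1)
    (g : supportSpan (grading Z σ m)) (hg : (g : Fin n → ℤ) ∈ periodLattice m) :
    (e g : Fin n → ℤ) ∈ periodLattice m' := by
  obtain ⟨f, hf, hfe⟩ := exists_isSpecialization he hσ' hm'
  obtain ⟨l, u, hu, h0⟩ := exists_eigenvector (Z := Z) hA hσ hm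
  obtain ⟨c, -, hc⟩ := hf.exists_scalar hA' hg
  let s : supportSpan (grading Z σ m) := ⟨l, mem_supportSpan_of_mem hu h0⟩
  have hu' : u ∈ eigenspace Z σ m (l + g) := by rwa [eigenspace_add_period l hg]
  have h1 := hfe s u hu
  have h2 := hfe (s + g) u hu'
  have h3 : f (u ⊗ₜ monomial k (l + g)) ∈ eigenspace Z σ' m' (e s) := by
    rw [hc l u hu]; exact Submodule.smul_mem _ _ h1.1
  have := sub_mem_periodLattice (fun h => h0 (h2.2 h)) h2.1 h3
  simpa [map_add] using this

theorem IsSupportIso.exists_conj [IsAlgClosed k]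
    {ψ : AlgIso k (multiloop Z σ m) (multiloop Z σ' m')}
    (hψ : IsSupportIso (grading Z σ m) (grading Z σ' m') ψ)
    (hA : IsCentralSimple k A) (hA' : IsCentralSimple k A')
    (hσ : ∀ i j, σ i * σ j = σ j * σ i) (hm : ∀ i, σ i ^ (m i : ℕ) = 1)
    (hσ' : ∀ i j, σ' i * σ' j = σ' j * σ' i) (hm' : ∀ i, σ' i ^ (m' i : ℕ) = 1) :
    ∃ (P : Matrix.GeneralLinearGroup (Fin n) ℤ) (φ : AlgIso k A A'),
      ∀ j, σ' j = conj φ (tuplePow σ P j) := by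
  obtain ⟨e, he⟩ := hψ
  have he' : ∀ l : supportSpan (grading Z σ' m'),
      (grading Z σ' m' l).map ψ.symm.toLinearEquiv.toLinearMap = grading Z σ m (e.symm l) := by
    intro l
    have h := he (e.symm l)
    rw [AddEquiv.apply_symm_apply] at h
    rw [← h, ← Submodule.map_comp]
    have h1 : ψ.symm.toLinearEquiv.toLinearMap ∘ₗ ψ.toLinearEquiv.toLinearMap = LinearMap.id :=
      LinearMap.ext ψ.symm_apply_self
    exact (congrArg (fun t => Submodule.map t (grading Z σ m (e.symm l))) h1).trans
      (Submodule.map_id _)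
  obtain ⟨P, hP⟩ := exists_generalLinear e (periodLattice_le_supportSpan hA.1 hσ hm)
    (periodLattice_le_supportSpan hA'.1 hσ' hm')
    (map_periodLattice he hA.1 hA' hσ hm hσ' hm')
    (map_periodLattice (e := e.symm) he' hA'.1 hA hσ' hm' hσ hm)
  obtain ⟨f, hf, hfe⟩ := exists_isSpecialization he hσ' hm'
  obtain ⟨φ, hφ⟩ := hf.exists_algIso hA.1 hA' hσ hm
  refine ⟨P, φ, fun j => ?_⟩
  -- Eigenvectors span `A`. On one of degree `l`, `φ u` has degree `e(l)`, whose rational index is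
  -- `(l/m) P`, the index of `u` for `σ^P`.
  have key : ∀ u, σ' j (φ u) = φ (tuplePow σ P j u) := by
    intro u
    have hu : u ∈ ⨆ l, eigenspace Z σ m l :=
      iSup_eigenspace_eq_top Z hσ hm ▸ Submodule.mem_top
    induction hu using Submodule.iSup_induction' with
    | zero => simp
    | add u v _ _ h h' => simp only [map_add, h, h']
    | mem l u hu =>
      rcases eq_or_ne u 0 with rfl | h0
      · simp
      · let s : supportSpan (grading Z σ m) := ⟨l, mem_supportSpan_of_mem hu h0⟩
        obtain ⟨c, hc⟩ := hφ l
        have h1 : φ u ∈ eigenspace Z σ' m' (e s) := by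
          rw [hc u hu]; exact Submodule.smul_mem _ _ (hfe s u hu).1
        rw [eigenspace_eq_ratEigenspace, hP s] at h1
        rw [eigenspace_eq_ratEigenspace] at hu
        have h2 := ratEigenspace_le_tuplePow Z σ P _ hu j
        rw [h1 j, h2, map_smul]
  ext v
  rw [AlgIso.conj_apply, ← key, AlgIso.self_apply_symm]

end SupportIso

end Multiloop

theorem proposition2p2p5 {k : Type*} [Field k] [CharZero k] [IsAlgClosed k]
    (Z : Multiloop.CompatibleRoots k)
    {A A' : Type*}
    [NonUnitalNonAssocRing A] [Module k A] [IsScalarTower k A A] [SMulCommClass k A A]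
    [NonUnitalNonAssocRing A'] [Module k A'] [IsScalarTower k A' A'] [SMulCommClass k A' A']
    (hA : Multiloop.IsCentralSimple k A) (hA' : Multiloop.IsCentralSimple k A')
    {n : ℕ} (σ : Fin n → Multiloop.Aut k A) (σ' : Fin n → Multiloop.Aut k A')
    (hσ : Multiloop.IsCFO σ) (hσ' : Multiloop.IsCFO σ')
    (m m' : Fin n → ℕ+)
    (hm : ∀ i, σ i ^ (m i : ℕ) = 1) (hm' : ∀ i, σ' i ^ (m' i : ℕ) = 1) :
    -- the criterion
    (Multiloop.MultiloopSupportIsomorphic Z σ m σ' m' ↔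
      ∃ (P : Matrix.GeneralLinearGroup (Fin n) ℤ) (φ : Multiloop.AlgIso k A A'),
        ∀ j, σ' j = Multiloop.conj φ (Multiloop.tuplePow σ P j)) ∧
    -- independence of `m` and `m'`
    (∀ r r' : Fin n → ℕ+, (∀ i, σ i ^ (r i : ℕ) = 1) → (∀ i, σ' i ^ (r' i : ℕ) = 1) →
      (Multiloop.MultiloopSupportIsomorphic Z σ m σ' m' ↔
        Multiloop.MultiloopSupportIsomorphic Z σ r σ' r')) ∧
    -- the support-isomorphism can be chosen to extend `φ` on `A^σ ⊗ 1`
    (∀ (P : Matrix.GeneralLinearGroup (Fin n) ℤ) (φ : Multiloop.AlgIso k A A'),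
      (∀ j, σ' j = Multiloop.conj φ (Multiloop.tuplePow σ P j)) →
      ∃ ψ : Multiloop.AlgIso k (Multiloop.multiloop Z σ m) (Multiloop.multiloop Z σ' m'),
        Multiloop.IsSupportIso (Multiloop.grading Z σ m) (Multiloop.grading Z σ' m') ψ ∧
        ∀ x : Multiloop.fixedPoints σ,
          (ψ (Multiloop.tmulOne Z σ m x) : A' ⊗[k] Multiloop.Laurent k n) =
            φ (x : A) ⊗ₜ[k] (1 : Multiloop.Laurent k n)) := by
  -- Proved for all admissible moduli at once: the right side does not mention them, which gives the
  -- independence claim.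
  have criterion : ∀ r r' : Fin n → ℕ+, (∀ i, σ i ^ (r i : ℕ) = 1) →
      (∀ i, σ' i ^ (r' i : ℕ) = 1) →
      (Multiloop.MultiloopSupportIsomorphic Z σ r σ' r' ↔
        ∃ (P : Matrix.GeneralLinearGroup (Fin n) ℤ) (φ : Multiloop.AlgIso k A A'),
          ∀ j, σ' j = Multiloop.conj φ (Multiloop.tuplePow σ P j)) := by
    intro r r' hr hr'
    constructor
    · rintro ⟨ψ, hψ⟩
      exact hψ.exists_conj hA hA' hσ.1 hr hσ'.1 hr'
    · rintro ⟨P, φ, hP⟩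
      obtain ⟨ψ, hψ, -⟩ := Multiloop.exists_isSupportIso Z hσ.1 hr hr' P φ hP
      exact ⟨ψ, hψ⟩
  exact ⟨criterion m m' hm hm',
    fun r r' hr hr' => (criterion m m' hm hm').trans (criterion r r' hr hr').symm,
    fun P φ hP => Multiloop.exists_isSupportIso Z hσ.1 hm hm' P φ hP⟩
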